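/- Let $\mathcal{L}_A=\{+,\cdot,\mathrm{S},<,0\}$ be the language of arithmetic. A $\Delta_0$-formula is an $\mathcal{L}_A$-formula all of whose quantifiers are of the form $\exists x<t$ or $\forall x<t$, with $t$ a term not containing $x$; a $\Sigma_1$-formula is a $\Delta_0$-formula preceded by a finite (possibly empty) block of existential quantifiers. $\mathrm{I}\Delta_0$ is $\mathrm{PA}^-$ (the theory of non-negative parts of discretely ordered rings) together with induction for $\Delta_0$-formulae with parameters, and $\mathrm{B}\Sigma_1$ consists of the universal closures of $$[\forall x<v\,\exists y\,\varphi(x,y)]\rightarrow\exists z\,[\forall x<v\,\exists y<z\,\varphi(x,y)],$$ where $\varphi$ is $\Sigma_1$ and may contain parameters. Call a $\Delta_0$-formula $\mathrm{Exp}(x,y)$ an exponentiation formula if $\mathrm{I}\Delta_0$ proves $\mathrm{Exp}(0,1)$ and the three statements $\forall x\,\exists^{\leq 1}y\,\mathrm{Exp}(x,y)$; $\forall x\,(\exists y\,\mathrm{Exp}(x,y)\rightarrow\forall z<x\,\exists y\,\mathrm{Exp}(z,y))$; $\forall x\,\forall y\,(\mathrm{Exp}(x,y)\rightarrow\mathrm{Exp}(x+1,2y))$.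 (It then defines the graph of the possibly partial function $x\mapsto 2^x$ in every model of $\mathrm{I}\Delta_0$.) Given such a formula, $\mathrm{Exp}$ also denotes the axiom $\forall x\,\exists y\,\mathrm{Exp}(x,y)$. **Theorem 3.2.** Let $\mathcal{M}\models\mathrm{I}\Delta_0$ have universe $M$, and let $j$ be a self-embedding of $\mathcal{M}$ (an isomorphism of $\mathcal{M}$ onto a submodel $j(\mathcal{M})$ of $\mathcal{M}$) that is nontrivial, i.e. not the identity map, and such that $j(\mathcal{M})\preceq_{\Delta_0}\mathcal{M}$, i.e. $\Delta_0$-formulae with parameters in $j(\mathcal{M})$ are absolute between $j(\mathcal{M})$ and $\mathcal{M}$. Put $$\mathrm{I}_{\mathrm{fix}}(j)=\{m\in M:\ j(x)=x\text{ for all }x\leq m\}.$$ Then an exponentiation formula exists, and for every exponentiation formula $\mathrm{Exp}(x,y)$ the set $\mathrm{I}_{\mathrm{fix}}(j)$ is the universe of a submodel of $\mathcal{M}$ that satisfies $\mathrm{I}\Delta_0+\mathrm{B}\Sigma_1+\mathrm{Exp}$. In particular, $\mathrm{I}_{\mathrm{fix}}(j)$ is closed under exponentiation: for every $a\in\mathrm{I}_{\mathrm{fix}}(j)$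 there is $b\in\mathrm{I}_{\mathrm{fix}}(j)$ with $\mathcal{M}\models\mathrm{Exp}(a,b)$. -/

import Mathlib

universe u

open FirstOrder

namespace Arith

/-! ### The language of arithmetic -/

/-- Function symbols of the language of arithmetic: `0`, `S`, `+`, `·`. -/
inductive Func : ℕ → Type
  | zero : Func 0
  | succ : Func 1
  | add : Func 2
  | mul : Func 2

/-- Relation symbols of the language of arithmetic: `<`. -/
inductive Rel : ℕ → Type
  | lt : Rel 2

end Arith

/-- The language `{+, ·, S, <, 0}` of first-order arithmetic. -/
def LA : Language := ⟨Arith.Func, Arith.Rel⟩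

namespace Arith

open FirstOrder.Language

section Terms

variable {β : Type u}

instance : Zero (LA.Term β) := ⟨Constants.term (L := LA) Func.zero⟩

instance : Add (LA.Term β) := ⟨Functions.apply₂ (L := LA) Func.add⟩

instance : Mul (LA.Term β) := ⟨Functions.apply₂ (L := LA) Func.mul⟩

/-- The term `S t`. -/
def S (t : LA.Term β) : LA.Term β := Functions.apply₁ (L := LA) Func.succ t

/-- The numeral `1`, that is, `S 0`. -/
instance : One (LA.Term β) := ⟨S 0⟩

/-- The atomic formula `t < s`. -/
def lt {n : ℕ} (t s : LA.Term (β ⊕ Fin n)) : LA.BoundedFormula β n :=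
  Relations.boundedFormula₂ (L := LA) Rel.lt t s

/-- Regard a term in which `n` quantifiable variables may occur as a term in which one further
variable `&n` may occur (but does not). -/
def wk {n : ℕ} (t : LA.Term (β ⊕ Fin n)) : LA.Term (β ⊕ Fin (n + 1)) :=
  t.relabel (Sum.map id Fin.castSucc)

/-- The bounded quantifier `∀ x < t, φ`, where the new variable `x = &n` does not occur in `t`. -/
def ballLT {n : ℕ} (t : LA.Term (β ⊕ Fin n)) (φ : LA.BoundedFormula β (n + 1)) :
    LA.BoundedFormula β n :=
  ∀' (lt (&(Fin.last n)) (wk t) ⟹ φ)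

/-- The bounded quantifier `∃ x < t, φ`, where the new variable `x = &n` does not occur in `t`. -/
def bexLT {n : ℕ} (t : LA.Term (β ⊕ Fin n)) (φ : LA.BoundedFormula β (n + 1)) :
    LA.BoundedFormula β n :=
  ∃' (lt (&(Fin.last n)) (wk t) ⊓ φ)

/-- `Δ₀`-formulae: all quantifiers are of the form `∀ x < t` or `∃ x < t`. -/
inductive IsDelta0 : ∀ {n : ℕ}, LA.BoundedFormula β n → Prop
  | falsum {n : ℕ} : IsDelta0 (⊥ : LA.BoundedFormula β n)
  | equal {n : ℕ} (t s : LA.Term (β ⊕ Fin n)) : IsDelta0 (t.bdEqual s)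
  | rel {n l : ℕ} (R : LA.Relations l) (ts : Fin l → LA.Term (β ⊕ Fin n)) :
      IsDelta0 (BoundedFormula.rel R ts)
  | imp {n : ℕ} {φ ψ : LA.BoundedFormula β n} :
      IsDelta0 φ → IsDelta0 ψ → IsDelta0 (φ ⟹ ψ)
  | ball {n : ℕ} (t : LA.Term (β ⊕ Fin n)) {φ : LA.BoundedFormula β (n + 1)} :
      IsDelta0 φ → IsDelta0 (ballLT t φ)
  | bex {n : ℕ} (t : LA.Term (β ⊕ Fin n)) {φ : LA.BoundedFormula β (n + 1)} :
      IsDelta0 φ → IsDelta0 (bexLT t φ)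

/-- `Σ₁`-formulae: a finite (possibly empty) block of existential quantifiers followed by a
`Δ₀`-formula. -/
inductive IsSigma1 : ∀ {n : ℕ}, LA.BoundedFormula β n → Prop
  | delta0 {n : ℕ} {φ : LA.BoundedFormula β n} : IsDelta0 φ → IsSigma1 φ
  | ex {n : ℕ} {φ : LA.BoundedFormula β (n + 1)} : IsSigma1 φ → IsSigma1 (∃' φ)

end Terms

/-! ### Theories -/

/-- `PA⁻`: the theory of non-negative parts of discretely ordered rings, with `S x = x + 1`. -/
inductive PAMinus : LA.Theory
  | add_assoc : PAMinus (∀' ∀' ∀' (((&0 + &1) + &2) =' (&0 + (&1 + &2))))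
  | add_comm : PAMinus (∀' ∀' ((&0 + &1) =' (&1 + &0)))
  | mul_assoc : PAMinus (∀' ∀' ∀' (((&0 * &1) * &2) =' (&0 * (&1 * &2))))
  | mul_comm : PAMinus (∀' ∀' ((&0 * &1) =' (&1 * &0)))
  | mul_add : PAMinus (∀' ∀' ∀' ((&0 * (&1 + &2)) =' (&0 * &1 + &0 * &2)))
  | add_zero : PAMinus (∀' ((&0 + 0) =' &0))
  | mul_zero : PAMinus (∀' ((&0 * 0) =' 0))
  | mul_one : PAMinus (∀' ((&0 * 1) =' &0))
  | succ_eq : PAMinus (∀' (S &0 =' (&0 + 1)))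
  | lt_trans : PAMinus (∀' ∀' ∀' (lt &0 &1 ⊓ lt &1 &2 ⟹ lt &0 &2))
  | lt_irrefl : PAMinus (∀' ∼(lt &0 &0))
  | lt_total : PAMinus (∀' ∀' (lt &0 &1 ⊔ ((&0 =' &1) ⊔ lt &1 &0)))
  | add_lt_add : PAMinus (∀' ∀' ∀' (lt &0 &1 ⟹ lt (&0 + &2) (&1 + &2)))
  | mul_lt_mul : PAMinus (∀' ∀' ∀' (lt 0 &2 ⊓ lt &0 &1 ⟹ lt (&0 * &2) (&1 * &2)))
  | exists_add : PAMinus (∀' ∀' (lt &0 &1 ⟹ ∃' ((&0 + &2) =' &1)))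
  | zero_lt_one : PAMinus (lt 0 1)
  | discrete : PAMinus (∀' (lt 0 &0 ⟹ (lt 1 &0 ⊔ (1 =' &0))))
  | nonneg : PAMinus (∀' (lt 0 &0 ⊔ (0 =' &0)))

/-- The formula `φ` with its free variables renamed along `g`, where a value `Sum.inr i` stands for
the quantifiable variable `&i`. -/
def ren {α β : Type} {n : ℕ} (g : α → β ⊕ Fin n) (φ : LA.Formula α) : LA.BoundedFormula β n :=
  BoundedFormula.relabel (k := 0) g φ

/-- The universal closure of a formula with `k` free variables. -/
def close {k : ℕ} (φ : LA.Formula (Fin k)) : LA.Sentence :=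
  (ren (Sum.inr : Fin k → Empty ⊕ Fin k) φ).alls

/-- The induction axiom for `φ(p, x)`, where `p` is a `k`-tuple of parameters: the universal
closure of `φ(p, 0) ∧ ∀ x (φ(p, x) → φ(p, S x)) → ∀ x φ(p, x)`. -/
def inductionAxiom {k : ℕ} (φ : LA.Formula (Fin k ⊕ Fin 1)) : LA.Sentence :=
  close <|
    (φ.subst (Sum.elim Term.var fun _ => 0) ⊓
      ∀' (ren id φ ⟹
        ren id (φ.subst
          (Sum.elim (fun i => Term.var (Sum.inl i)) fun i => S (Term.var (Sum.inr i)))))) ⟹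
      ∀' (ren id φ)

/-- The collection axiom for `φ(p, x, y)`, where `p` is a `k`-tuple of parameters: the universal
closure of `(∀ x < v, ∃ y, φ(p, x, y)) → ∃ z, ∀ x < v, ∃ y < z, φ(p, x, y)`.
In the antecedent the variables `v, x, y` are `&0, &1, &2`; in the consequent the variables
`v, z, x, y` are `&0, &1, &2, &3`. -/
def collectionAxiom {k : ℕ} (φ : LA.Formula (Fin k ⊕ Fin 2)) : LA.Sentence :=
  close <|
    ∀' (ballLT &0 (∃' (ren (n := 3) (Sum.map id ![1, 2]) φ)) ⟹
      ∃' (ballLT &0 (bexLT &1 (ren (n := 4) (Sum.map id ![2, 3]) φ))))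

/-- `IΔ₀`: `PA⁻` together with induction for `Δ₀`-formulae (with parameters). -/
def IDelta0 : LA.Theory :=
  PAMinus ∪ {σ | ∃ (k : ℕ) (φ : LA.Formula (Fin k ⊕ Fin 1)), IsDelta0 φ ∧ σ = inductionAxiom φ}

/-- `BΣ₁`: the collection scheme for `Σ₁`-formulae (with parameters). -/
def BSigma1 : LA.Theory :=
  {σ | ∃ (k : ℕ) (φ : LA.Formula (Fin k ⊕ Fin 2)), IsSigma1 φ ∧ σ = collectionAxiom φ}

/-! ### The graph of exponentiation -/

/-- `E(t, s)`, for a formula `E` in two free variables and terms `t`, `s`. -/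
def app {n : ℕ} (E : LA.Formula (Fin 2)) (t s : LA.Term (Empty ⊕ Fin n)) :
    LA.BoundedFormula Empty n :=
  ren id (E.subst ![t, s])

/-- `E(x, y)` is a `Δ₀`-formula which `IΔ₀` proves to be the graph of `x ↦ 2 ^ x`, a possibly
partial function whose domain is an initial segment. Any two such formulae are `IΔ₀`-provably
equivalent. -/
structure IsExpGraph (E : LA.Formula (Fin 2)) : Prop where
  delta0 : IsDelta0 E
  /-- `E(0, 1)`. -/
  zero : IDelta0 ⊨ᵇ (app E 0 1 : LA.Sentence)
  /-- For every `x` there is at most one `y` with `E(x, y)`. -/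
  unique : IDelta0 ⊨ᵇ (∀' ∀' ∀' (app E &0 &1 ⊓ app E &0 &2 ⟹ (&1 =' &2)) : LA.Sentence)
  /-- If `E(x, y)` for some `y` and `z < x`, then `E(z, y)` for some `y`. -/
  initial : IDelta0 ⊨ᵇ
    (∀' ((∃' app E &0 &1) ⟹ ballLT &0 (∃' app E &1 &2)) : LA.Sentence)
  /-- `E(x, y)` implies `E(x + 1, 2 * y)`. -/
  succ : IDelta0 ⊨ᵇ
    (∀' ∀' (app E &0 &1 ⟹ app E (&0 + 1) ((1 + 1) * &1)) : LA.Sentence)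

/-- The axiom `∀ x ∃ y E(x, y)`. -/
def totality (E : LA.Formula (Fin 2)) : LA.Sentence := ∀' ∃' app E &0 &1

/-! ### Self-embeddings -/

section Models

variable {M : Type u} [LA.Structure M]

/-- The order of an `LA`-structure. -/
def Lt (a b : M) : Prop := Structure.RelMap (L := LA) Rel.lt ![a, b]

/-- `N ≼_{Δ₀} M`: `Δ₀`-formulae with parameters in `N` are absolute between `N` and `M`. -/
def IsDelta0Elementary (N : LA.Substructure M) : Prop :=
  ∀ (k : ℕ) (φ : LA.Formula (Fin k)), IsDelta0 φ →
    ∀ a : Fin k → N, φ.Realize a ↔ φ.Realize (fun i => (a i : M))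

/-- `I_fix(j)`, the longest initial segment of fixed points of `j`: the set of all `m` such that
`j x = x` for every `x ≤ m`. -/
def Ifix (j : M ↪[LA] M) : Set M := {m | ∀ x : M, Lt x m ∨ x = m → j x = x}

end Models

end Arith

/-!
If `x` and `j x` differ, so do their truncations `⌊x / 2 ^ i⌋` and `⌊j x / 2 ^ i⌋`, at first for
`i = 0`. As long as `i` is fixed by `j`, so is `2 ^ i`, hence the second truncation is the image of
the first, and dropping one more binary digit cannot make them agree. By `Δ₀`-induction they differ
for all `i ≤ a` if `a ∈ Ifix j`, so that every `x < 2 ^ a` is fixed, and so is every `x` if `2 ^ a`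
does not exist. Thus `Ifix j` is closed under exponentiation. Being a proper initial segment `I`, it
satisfies `BΣ₁`: when the block of quantifiers of a `Σ₁`-formula is bounded by `b ∉ I`, a witness
below `b` exists for each `x < v`, and the least `b` with this property belongs to `I`.

An exponentiation formula is obtained from `(m + 1) ^ n ≡ 1 + n * m` modulo `m ^ 2`, by which the
powers of a power of two `m + 1` determine their exponents, as long as these are below `m`. The
small powers of two are treated as quotients `(2 * m + 2) ^ r / (m + 1) ^ r`.
-/

namespace Arith

open FirstOrder.Language

section Realize

variable {M : Type u} [LA.Structure M] {β : Type*} {n : ℕ}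

/-- The element `0` of an `LA`-structure. -/
def interpZero (M : Type u) [LA.Structure M] : M := Structure.funMap (L := LA) Func.zero ![]

/-- The successor function of an `LA`-structure. -/
def interpSucc (a : M) : M := Structure.funMap (L := LA) Func.succ ![a]

/-- The addition of an `LA`-structure. -/
def interpAdd (a b : M) : M := Structure.funMap (L := LA) Func.add ![a, b]

/-- The multiplication of an `LA`-structure. -/
def interpMul (a b : M) : M := Structure.funMap (L := LA) Func.mul ![a, b]

@[simp] lemma realize_zero (v : β → M) : (0 : LA.Term β).realize v = interpZero M :=
  (Term.realize_constants (L := LA) (c := Func.zero)).trans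
    (congrArg (Structure.funMap (L := LA) Func.zero) (Subsingleton.elim _ _))

@[simp] lemma realize_S (t : LA.Term β) (v : β → M) :
    (S t).realize v = interpSucc (t.realize v) :=
  Term.realize_functions_apply₁

@[simp] lemma realize_one (v : β → M) : (1 : LA.Term β).realize v = interpSucc (interpZero M) :=
  (realize_S _ _).trans (by rw [realize_zero])

@[simp] lemma realize_add (t s : LA.Term β) (v : β → M) :
    (t + s).realize v = interpAdd (t.realize v) (s.realize v) :=
  Term.realize_functions_apply₂

@[simp] lemma realize_mul (t s : LA.Term β) (v : β → M) :
    (t * s).realize v = interpMul (t.realize v) (s.realize v) :=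
  Term.realize_functions_apply₂

@[simp] lemma realize_lt (t s : LA.Term (β ⊕ Fin n)) (v : β → M) (xs : Fin n → M) :
    (lt t s).Realize v xs ↔ Lt (t.realize (Sum.elim v xs)) (s.realize (Sum.elim v xs)) :=
  BoundedFormula.realize_rel₂

@[simp] lemma realize_wk (t : LA.Term (β ⊕ Fin n)) (v : β → M) (xs : Fin n → M) (a : M) :
    (wk t).realize (Sum.elim v (Fin.snoc xs a : Fin (n + 1) → M)) =
      t.realize (Sum.elim v xs) := by
  rw [wk, Term.realize_relabel]
  congr 1
  ext i
  cases i <;> simp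

@[simp] lemma realize_ballLT (t : LA.Term (β ⊕ Fin n)) (φ : LA.BoundedFormula β (n + 1))
    (v : β → M) (xs : Fin n → M) :
    (ballLT t φ).Realize v xs ↔
      ∀ a, Lt a (t.realize (Sum.elim v xs)) → φ.Realize v (Fin.snoc xs a) := by
  simp [ballLT]

@[simp] lemma realize_bexLT (t : LA.Term (β ⊕ Fin n)) (φ : LA.BoundedFormula β (n + 1))
    (v : β → M) (xs : Fin n → M) :
    (bexLT t φ).Realize v xs ↔
      ∃ a, Lt a (t.realize (Sum.elim v xs)) ∧ φ.Realize v (Fin.snoc xs a) := by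
  simp [bexLT]

@[simp] lemma realize_ren {α β : Type} {n : ℕ} (g : α → β ⊕ Fin n) (φ : LA.Formula α) (v : β → M)
    (xs : Fin n → M) : (ren g φ).Realize v xs ↔ φ.Realize (Sum.elim v xs ∘ g) := by
  rw [ren, BoundedFormula.realize_relabel, Formula.Realize]
  exact iff_of_eq (congrArg₂ _ rfl (Subsingleton.elim _ _))

@[simp] lemma realize_app (E : LA.Formula (Fin 2)) (t s : LA.Term (Empty ⊕ Fin n)) (v : Empty → M)
    (xs : Fin n → M) : (app E t s).Realize v xs ↔
      E.Realize ![t.realize (Sum.elim v xs), s.realize (Sum.elim v xs)] := by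
  rw [app, realize_ren, Formula.Realize, BoundedFormula.realize_subst, Formula.Realize]
  refine iff_of_eq (congrArg₂ _ (funext fun i => ?_) rfl)
  fin_cases i <;> rfl

lemma realize_close {k : ℕ} (φ : LA.Formula (Fin k)) :
    M ⊨ close φ ↔ ∀ v : Fin k → M, φ.Realize v := by
  rw [close, Sentence.Realize]
  exact BoundedFormula.realize_alls.trans <| forall_congr' fun v => by rw [realize_ren]; rfl

lemma realize_inductionAxiom {k : ℕ} (φ : LA.Formula (Fin k ⊕ Fin 1)) :
    M ⊨ inductionAxiom φ ↔ ∀ p : Fin k → M,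
      φ.Realize (Sum.elim p fun _ => interpZero M) →
      (∀ x, φ.Realize (Sum.elim p fun _ => x) → φ.Realize (Sum.elim p fun _ => interpSucc x)) →
      ∀ x, φ.Realize (Sum.elim p fun _ => x) := by
  rw [inductionAxiom, realize_close]
  refine forall_congr' fun p => ?_
  have elim_snoc (x : M) :
      Sum.elim p (Fin.snoc default x : Fin 1 → M) = Sum.elim p fun _ => x := rfl
  have subst_zero : (fun i => (Sum.elim Term.var (fun _ => 0) i : LA.Term (Fin k)).realize p) =
      Sum.elim p fun _ : Fin 1 => interpZero M := by
    ext (i | i) <;> simp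
  have subst_succ (x : M) : (fun i => (Sum.elim (fun i => Term.var (Sum.inl i))
      (fun i => S (Term.var (Sum.inr i))) i : LA.Term (Fin k ⊕ Fin 1)).realize
        (Sum.elim p fun _ => x)) = Sum.elim p fun _ : Fin 1 => interpSucc x := by
    ext (i | i) <;> simp
  simp only [Formula.Realize, BoundedFormula.realize_imp, BoundedFormula.realize_inf,
    BoundedFormula.realize_all, realize_ren, Function.comp_id, elim_snoc,
    BoundedFormula.realize_subst, subst_zero, subst_succ, and_imp]

end Realize

section Axioms

variable {M : Type u} [LA.Structure M]

/-- The axioms of `PA⁻`, stated for the operations and the order of an `LA`-structure. -/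
structure PAMinusLaws (M : Type u) [LA.Structure M] : Prop where
  add_assoc (a b c : M) : interpAdd (interpAdd a b) c = interpAdd a (interpAdd b c)
  add_comm (a b : M) : interpAdd a b = interpAdd b a
  mul_assoc (a b c : M) : interpMul (interpMul a b) c = interpMul a (interpMul b c)
  mul_comm (a b : M) : interpMul a b = interpMul b a
  mul_add (a b c : M) : interpMul a (interpAdd b c) = interpAdd (interpMul a b) (interpMul a c)
  add_zero (a : M) : interpAdd a (interpZero M) = a
  mul_zero (a : M) : interpMul a (interpZero M) = interpZero M
  mul_one (a : M) : interpMul a (interpSucc (interpZero M)) = a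
  succ_eq (a : M) : interpSucc a = interpAdd a (interpSucc (interpZero M))
  lt_trans (a b c : M) : Lt a b → Lt b c → Lt a c
  lt_irrefl (a : M) : ¬Lt a a
  lt_total (a b : M) : Lt a b ∨ a = b ∨ Lt b a
  add_lt_add (a b c : M) : Lt a b → Lt (interpAdd a c) (interpAdd b c)
  mul_lt_mul (a b c : M) : Lt (interpZero M) c → Lt a b → Lt (interpMul a c) (interpMul b c)
  exists_add (a b : M) : Lt a b → ∃ c, interpAdd a c = b
  zero_lt_one : Lt (interpZero M) (interpSucc (interpZero M))
  discrete (a : M) : Lt (interpZero M) a →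
    Lt (interpSucc (interpZero M)) a ∨ interpSucc (interpZero M) = a
  nonneg (a : M) : Lt (interpZero M) a ∨ interpZero M = a

lemma realize_of_PAMinus (h : M ⊨ PAMinus) {σ : LA.Sentence} (hσ : PAMinus σ) {P : Prop}
    (e : M ⊨ σ ↔ P := by simp [Sentence.Realize, Formula.Realize, Fin.snoc]) : P :=
  e.1 (h.realize_of_mem σ hσ)

lemma models_PAMinus_iff : M ⊨ PAMinus ↔ PAMinusLaws M where
  mp h :=
    { add_assoc := realize_of_PAMinus h .add_assoc
      add_comm := realize_of_PAMinus h .add_comm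
      mul_assoc := realize_of_PAMinus h .mul_assoc
      mul_comm := realize_of_PAMinus h .mul_comm
      mul_add := realize_of_PAMinus h .mul_add
      add_zero := realize_of_PAMinus h .add_zero
      mul_zero := realize_of_PAMinus h .mul_zero
      mul_one := realize_of_PAMinus h .mul_one
      succ_eq := realize_of_PAMinus h .succ_eq
      lt_trans := realize_of_PAMinus h .lt_trans
      lt_irrefl := realize_of_PAMinus h .lt_irrefl
      lt_total := realize_of_PAMinus h .lt_total
      add_lt_add := realize_of_PAMinus h .add_lt_add
      mul_lt_mul := realize_of_PAMinus h .mul_lt_mul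
      exists_add := realize_of_PAMinus h .exists_add
      zero_lt_one := realize_of_PAMinus h .zero_lt_one
      discrete := realize_of_PAMinus h .discrete
      nonneg := realize_of_PAMinus h .nonneg }
  mpr h := by
    refine ⟨fun σ hσ => ?_⟩
    obtain ⟨⟩ := h
    cases hσ <;> simpa [Sentence.Realize, Formula.Realize, Fin.snoc]

lemma models_IDelta0_iff : M ⊨ IDelta0 ↔ PAMinusLaws M ∧
    ∀ (k : ℕ) (φ : LA.Formula (Fin k ⊕ Fin 1)), IsDelta0 φ → ∀ p : Fin k → M,
      φ.Realize (Sum.elim p fun _ => interpZero M) →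
      (∀ x, φ.Realize (Sum.elim p fun _ => x) → φ.Realize (Sum.elim p fun _ => interpSucc x)) →
      ∀ x, φ.Realize (Sum.elim p fun _ => x) := by
  rw [IDelta0, Theory.model_union_iff, models_PAMinus_iff, Theory.model_iff]
  refine and_congr_right fun _ =>
    ⟨fun h k φ hφ => (realize_inductionAxiom φ).1 (h _ ⟨k, φ, hφ, rfl⟩), ?_⟩
  rintro h _ ⟨k, φ, hφ, rfl⟩
  exact (realize_inductionAxiom φ).2 (h k φ hφ)

end Axioms

section Substitution

variable {α β : Type*}

lemma IsDelta0.not {n : ℕ} {φ : LA.BoundedFormula α n} (h : IsDelta0 φ) : IsDelta0 φ.not :=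
  .imp h .falsum

lemma relabel_lt {n k : ℕ} (g : α → β ⊕ Fin n) (t s : LA.Term (α ⊕ Fin k)) :
    (lt t s).relabel g = lt (t.relabel (BoundedFormula.relabelAux g k))
      (s.relabel (BoundedFormula.relabelAux g k)) := by
  refine congrArg (BoundedFormula.rel _) (funext fun i => ?_)
  fin_cases i <;> rfl

lemma relabel_wk {n k : ℕ} (g : α → β ⊕ Fin n) (t : LA.Term (α ⊕ Fin k)) :
    (wk t).relabel (BoundedFormula.relabelAux g (k + 1)) =
      wk (t.relabel (BoundedFormula.relabelAux g k)) := by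
  rw [wk, wk, Term.relabel_relabel, Term.relabel_relabel]
  congr 1
  ext (i | i)
  · rcases hi : g i with j | j <;> simp [BoundedFormula.relabelAux, hi]
    rfl
  · simp [BoundedFormula.relabelAux]

lemma relabel_last {n k : ℕ} (g : α → β ⊕ Fin n) :
    (&(Fin.last k) : LA.Term (α ⊕ Fin (k + 1))).relabel (BoundedFormula.relabelAux g (k + 1)) =
      &(Fin.last (n + k)) := by
  simp [BoundedFormula.relabelAux]

lemma relabel_ballLT {n k : ℕ} (g : α → β ⊕ Fin n) (t : LA.Term (α ⊕ Fin k))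
    (φ : LA.BoundedFormula α (k + 1)) : (ballLT t φ).relabel g =
      ballLT (t.relabel (BoundedFormula.relabelAux g k)) (φ.relabel g) := by
  rw [ballLT, BoundedFormula.relabel_all, BoundedFormula.relabel_imp, relabel_lt, relabel_wk,
    relabel_last]
  rfl

lemma relabel_bexLT {n k : ℕ} (g : α → β ⊕ Fin n) (t : LA.Term (α ⊕ Fin k))
    (φ : LA.BoundedFormula α (k + 1)) : (bexLT t φ).relabel g =
      bexLT (t.relabel (BoundedFormula.relabelAux g k)) (φ.relabel g) := by
  rw [bexLT, BoundedFormula.relabel_ex, bexLT, ← relabel_last g, ← relabel_wk g, ← relabel_lt]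
  rfl

theorem IsDelta0.relabel {n k : ℕ} {φ : LA.BoundedFormula α k} (h : IsDelta0 φ)
    (g : α → β ⊕ Fin n) : IsDelta0 (φ.relabel g) := by
  induction h with
  | falsum => exact .falsum
  | equal t s => exact .equal _ _
  | rel R ts => exact .rel _ _
  | imp _ _ ih₁ ih₂ => exact .imp ih₁ ih₂
  | ball t _ ih => exact relabel_ballLT g t _ ▸ .ball _ ih
  | bex t _ ih => exact relabel_bexLT g t _ ▸ .bex _ ih

/-- The substitution which `BoundedFormula.subst f` performs on the terms of a formula with `k`
quantifiable variables. -/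
def substAux (f : α → LA.Term β) (k : ℕ) : α ⊕ Fin k → LA.Term (β ⊕ Fin k) :=
  Sum.elim (Term.relabel Sum.inl ∘ f) (Term.var ∘ Sum.inr)

lemma subst_lt {k : ℕ} (f : α → LA.Term β) (t s : LA.Term (α ⊕ Fin k)) :
    (lt t s).subst f = lt (t.subst (substAux f k)) (s.subst (substAux f k)) := by
  refine congrArg (BoundedFormula.rel _) (funext fun i => ?_)
  fin_cases i <;> rfl

lemma subst_wk {k : ℕ} (f : α → LA.Term β) (t : LA.Term (α ⊕ Fin k)) :
    (wk t).subst (substAux f (k + 1)) = wk (t.subst (substAux f k)) := by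
  induction t with
  | var i =>
    rcases i with i | i
    · simp only [wk, substAux, Term.relabel, Term.subst, Sum.map_inl, Sum.elim_inl,
        Function.comp_apply, Term.relabel_relabel, id]
      rfl
    · rfl
  | func F ts ih => exact congrArg (Term.func F) (funext ih)

theorem IsDelta0.subst {k : ℕ} {φ : LA.BoundedFormula α k} (h : IsDelta0 φ)
    (f : α → LA.Term β) : IsDelta0 (φ.subst f) := by
  induction h with
  | falsum => exact .falsum
  | equal t s => exact .equal _ _
  | rel R ts => exact .rel _ _
  | imp _ _ ih₁ ih₂ => exact .imp ih₁ ih₂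
  | ball t _ ih =>
    change IsDelta0 ((lt _ _).subst f ⟹ _).all
    rw [subst_lt, subst_wk]
    exact .ball _ ih
  | bex t _ ih =>
    change IsDelta0 ((lt _ _).subst f ⊓ _).ex
    rw [subst_lt, subst_wk]
    exact .bex _ ih

lemma realize_congr_freeVar {M : Type*} [LA.Structure M] [DecidableEq α] {n : ℕ}
    (φ : LA.BoundedFormula α n) {v w : α → M} (xs : Fin n → M)
    (h : ∀ a ∈ φ.freeVarFinset, v a = w a) : φ.Realize v xs ↔ φ.Realize w xs := by
  rw [← BoundedFormula.realize_restrictFreeVar (f := Subtype.val) (v := v) v fun _ => rfl,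
    BoundedFormula.realize_restrictFreeVar (f := Subtype.val) (v := v) w fun a => h a a.2]

end Substitution

section Models

variable (M : Theory.ModelType.{0, 0, u} IDelta0)

lemma paMinusLaws : PAMinusLaws M := (models_IDelta0_iff.1 M.is_model).1

instance : Zero M := ⟨interpZero M⟩

instance : One M := ⟨interpSucc (interpZero M)⟩

instance : Add M := ⟨interpAdd⟩

instance : Mul M := ⟨interpMul⟩

lemma interpZero_eq : interpZero M = 0 := rfl

lemma interpSucc_eq (a : M) : interpSucc a = a + 1 := (paMinusLaws M).succ_eq a

instance : CommSemiring M where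
  add_assoc := (paMinusLaws M).add_assoc
  add_comm := (paMinusLaws M).add_comm
  add_zero := (paMinusLaws M).add_zero
  zero_add a := ((paMinusLaws M).add_comm _ _).trans ((paMinusLaws M).add_zero a)
  mul_assoc := (paMinusLaws M).mul_assoc
  mul_comm := (paMinusLaws M).mul_comm
  mul_zero := (paMinusLaws M).mul_zero
  zero_mul a := ((paMinusLaws M).mul_comm _ _).trans ((paMinusLaws M).mul_zero a)
  mul_one := (paMinusLaws M).mul_one
  one_mul a := ((paMinusLaws M).mul_comm _ _).trans ((paMinusLaws M).mul_one a)
  left_distrib := (paMinusLaws M).mul_add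
  right_distrib a b c :=
    ((paMinusLaws M).mul_comm _ _).trans <| ((paMinusLaws M).mul_add _ _ _).trans <|
      congrArg₂ _ ((paMinusLaws M).mul_comm _ _) ((paMinusLaws M).mul_comm _ _)
  nsmul := nsmulRec

instance : IsStrictTotalOrder M Lt where
  irrefl := (paMinusLaws M).lt_irrefl
  trans := (paMinusLaws M).lt_trans
  trichotomous a b hab hba := by simpa [hab, hba] using (paMinusLaws M).lt_total a b

noncomputable instance : LinearOrder M :=
  have := Classical.decRel (Lt (M := M))
  linearOrderOfSTO Lt

instance : IsOrderedCancelAddMonoid M where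
  add_le_add_left a b h c := h.elim (fun h => .inl (h ▸ rfl))
    fun h => .inr ((paMinusLaws M).add_lt_add _ _ _ h)
  le_of_add_le_add_left a b c h := by
    contrapose! h
    rw [add_comm a, add_comm a]
    exact (paMinusLaws M).add_lt_add _ _ _ h

instance : IsStrictOrderedRing M where
  zero_le_one := .inr (paMinusLaws M).zero_lt_one
  exists_pair_ne := ⟨0, 1, ne_of_lt (paMinusLaws M).zero_lt_one⟩
  mul_lt_mul_of_pos_left a ha b c h := by
    rw [mul_comm a, mul_comm a]
    exact (paMinusLaws M).mul_lt_mul _ _ _ ha h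
  mul_lt_mul_of_pos_right a ha b c h := (paMinusLaws M).mul_lt_mul _ _ _ ha h

instance : CanonicallyOrderedAdd M where
  exists_add_of_le h := h.elim
    (fun h => ⟨0, h ▸ (add_zero _).symm⟩)
    fun h => ((paMinusLaws M).exists_add _ _ h).imp fun _ hc => hc.symm
  le_add_self _ b := le_add_of_nonneg_left (((paMinusLaws M).nonneg b).symm)
  le_self_add _ b := le_add_of_nonneg_right (((paMinusLaws M).nonneg b).symm)

instance : SuccAddOrder M where
  succ a := a + 1
  le_succ _ := le_self_add
  max_of_succ_le h := absurd h (lt_add_of_pos_right _ zero_lt_one).not_ge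
  succ_le_of_lt {a b} h := by
    obtain ⟨c, rfl⟩ := exists_add_of_le h.le
    have one_le : 1 ≤ c := ((paMinusLaws M).discrete c (pos_of_lt_add_right h)).symm
    gcongr
  succ_eq_add_one _ := rfl

end Models

section Definability

variable {I : Type*} {𝓜 : I → Theory.ModelType.{0, 0, u} IDelta0} {Γ : Type*} {ρ : ∀ i, Γ → 𝓜 i}
  {α β : Type*}

/-- A family of functions on the models `𝓜 i`, all of them given by one term in which the elements
`ρ i c` may occur as parameters. -/
def TermDefinable (ρ : ∀ i, Γ → 𝓜 i) (f : ∀ i, (α → 𝓜 i) → 𝓜 i) : Prop :=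
  ∃ t : LA.Term (Γ ⊕ α), ∀ i v, t.realize (Sum.elim (ρ i) v) = f i v

/-- A family of relations on the models `𝓜 i`, all of them given by one `Δ₀`-formula in which the
elements `ρ i c` may occur as parameters. -/
def Delta0Definable (ρ : ∀ i, Γ → 𝓜 i) (P : ∀ i, (α → 𝓜 i) → Prop) : Prop :=
  ∃ φ : LA.Formula (Γ ⊕ α), IsDelta0 φ ∧ ∀ i v, φ.Realize (Sum.elim (ρ i) v) ↔ P i v

namespace TermDefinable

lemma var (a : α) : TermDefinable ρ fun _ v => v a := ⟨Term.var (Sum.inr a), fun _ _ => rfl⟩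

lemma cst (c : Γ) : TermDefinable ρ (α := α) fun i _ => ρ i c :=
  ⟨Term.var (Sum.inl c), fun _ _ => rfl⟩

lemma zero : TermDefinable ρ (α := α) fun _ _ => 0 := ⟨0, fun _ _ => realize_zero _⟩

lemma one : TermDefinable ρ (α := α) fun _ _ => 1 := ⟨1, fun _ _ => realize_one _⟩

variable {f g : ∀ i, (α → 𝓜 i) → 𝓜 i}

lemma add (hf : TermDefinable ρ f) (hg : TermDefinable ρ g) :
    TermDefinable ρ fun i v => f i v + g i v := by
  obtain ⟨t, ht⟩ := hf
  obtain ⟨s, hs⟩ := hg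
  exact ⟨t + s, fun i v => (realize_add _ _ _).trans (congrArg₂ _ (ht i v) (hs i v))⟩

lemma mul (hf : TermDefinable ρ f) (hg : TermDefinable ρ g) :
    TermDefinable ρ fun i v => f i v * g i v := by
  obtain ⟨t, ht⟩ := hf
  obtain ⟨s, hs⟩ := hg
  exact ⟨t * s, fun i v => (realize_mul _ _ _).trans (congrArg₂ _ (ht i v) (hs i v))⟩

lemma natCast (n : ℕ) : TermDefinable ρ (α := α) fun _ _ => n := by
  induction n with
  | zero => simpa using zero
  | succ n ih => simpa using ih.add one

lemma ofNat (n : ℕ) [n.AtLeastTwo] : TermDefinable ρ (α := α) fun _ _ => ofNat(n) := natCast n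

lemma pow (hf : TermDefinable ρ f) (n : ℕ) : TermDefinable ρ fun i v => f i v ^ n := by
  induction n with
  | zero => simpa using one
  | succ n ih => simpa [pow_succ] using ih.mul hf

end TermDefinable

namespace Delta0Definable

variable {P Q : ∀ i, (α → 𝓜 i) → Prop} {f g : ∀ i, (α → 𝓜 i) → 𝓜 i}

lemma of_iff (h : Delta0Definable ρ P) (e : ∀ i v, Q i v ↔ P i v) : Delta0Definable ρ Q := by
  obtain ⟨φ, hφ, h⟩ := h
  exact ⟨φ, hφ, fun i v => (h i v).trans (e i v).symm⟩

lemma eq (hf : TermDefinable ρ f) (hg : TermDefinable ρ g) :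
    Delta0Definable ρ fun i v => f i v = g i v := by
  obtain ⟨t, ht⟩ := hf
  obtain ⟨s, hs⟩ := hg
  refine ⟨(t.relabel Sum.inl).bdEqual (s.relabel Sum.inl), .equal _ _, fun i v => ?_⟩
  rw [Formula.Realize, BoundedFormula.realize_bdEqual, Term.realize_relabel, Term.realize_relabel,
    Sum.elim_comp_inl, ht, hs]

lemma lt (hf : TermDefinable ρ f) (hg : TermDefinable ρ g) :
    Delta0Definable ρ fun i v => f i v < g i v := by
  obtain ⟨t, ht⟩ := hf
  obtain ⟨s, hs⟩ := hg
  refine ⟨Arith.lt (t.relabel Sum.inl) (s.relabel Sum.inl), .rel _ _, fun i v => ?_⟩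
  rw [Formula.Realize, realize_lt, Term.realize_relabel, Term.realize_relabel,
    Sum.elim_comp_inl, ht, hs]
  rfl

lemma not (h : Delta0Definable ρ P) : Delta0Definable ρ fun i v => ¬P i v := by
  obtain ⟨φ, hφ, h⟩ := h
  exact ⟨_, hφ.not, fun i v => Formula.realize_not.trans (not_congr (h i v))⟩

lemma imp (h : Delta0Definable ρ P) (h' : Delta0Definable ρ Q) :
    Delta0Definable ρ fun i v => P i v → Q i v := by
  obtain ⟨φ, hφ, h⟩ := h
  obtain ⟨ψ, hψ, h'⟩ := h'
  exact ⟨_, hφ.imp hψ, fun i v => Formula.realize_imp.trans (imp_congr (h i v) (h' i v))⟩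

lemma and (h : Delta0Definable ρ P) (h' : Delta0Definable ρ Q) :
    Delta0Definable ρ fun i v => P i v ∧ Q i v :=
  ((h.imp h'.not).not).of_iff fun _ _ => by tauto

lemma or (h : Delta0Definable ρ P) (h' : Delta0Definable ρ Q) :
    Delta0Definable ρ fun i v => P i v ∨ Q i v :=
  (h.not.imp h').of_iff fun _ _ => by tauto

lemma le (hf : TermDefinable ρ f) (hg : TermDefinable ρ g) :
    Delta0Definable ρ fun i v => f i v ≤ g i v :=
  (lt hg hf).not.of_iff fun _ _ => by rw [not_lt]

section BoundedQuantifiers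

variable {Q : ∀ i, (α → 𝓜 i) → 𝓜 i → Prop}

lemma bexLT (hf : TermDefinable ρ f)
    (h : Delta0Definable ρ (α := Option α) fun i w => Q i (fun a => w (some a)) (w none)) :
    Delta0Definable ρ fun i v => ∃ x < f i v, Q i v x := by
  obtain ⟨t, ht⟩ := hf
  obtain ⟨φ, hφ, h⟩ := h
  let r : Γ ⊕ Option α → (Γ ⊕ α) ⊕ Fin 1 :=
    Sum.elim (Sum.inl ∘ Sum.inl) fun a => a.elim (Sum.inr 0) (Sum.inl ∘ Sum.inr)
  refine ⟨Arith.bexLT (n := 0) (t.relabel Sum.inl) (BoundedFormula.relabel (n := 1) (k := 0) r φ),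
    .bex _ (hφ.relabel r), fun i v => ?_⟩
  rw [Formula.Realize, realize_bexLT, Term.realize_relabel, Sum.elim_comp_inl, ht]
  refine exists_congr fun x => and_congr_right fun _ => Iff.trans ?_ (h i fun a => a.elim x v)
  refine (BoundedFormula.realize_relabel (m := 1) (n := 0)).trans ?_
  refine iff_of_eq (congrArg₂ _ (funext fun a => ?_) (Subsingleton.elim _ _))
  rcases a with a | _ | a
  · rfl
  · exact Fin.snoc_last (n := 0) (α := fun _ => 𝓜 i) x default
  · rfl

lemma ballLT (hf : TermDefinable ρ f)
    (h : Delta0Definable ρ (α := Option α) fun i w => Q i (fun a => w (some a)) (w none)) :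
    Delta0Definable ρ fun i v => ∀ x < f i v, Q i v x :=
  (bexLT (Q := fun i v x => ¬Q i v x) hf h.not).not.of_iff fun _ _ => by push Not; rfl

lemma bexLE (hf : TermDefinable ρ f)
    (h : Delta0Definable ρ (α := Option α) fun i w => Q i (fun a => w (some a)) (w none)) :
    Delta0Definable ρ fun i v => ∃ x ≤ f i v, Q i v x :=
  (bexLT (hf.add .one) h).of_iff fun _ _ => by simp only [Order.lt_add_one_iff]

lemma ballLE (hf : TermDefinable ρ f)
    (h : Delta0Definable ρ (α := Option α) fun i w => Q i (fun a => w (some a)) (w none)) :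
    Delta0Definable ρ fun i v => ∀ x ≤ f i v, Q i v x :=
  (ballLT (hf.add .one) h).of_iff fun _ _ => by simp only [Order.lt_add_one_iff]

end BoundedQuantifiers

lemma subst {R : ∀ i, (β → 𝓜 i) → Prop} (h : Delta0Definable ρ R)
    {F : β → ∀ i, (α → 𝓜 i) → 𝓜 i} (hF : ∀ b, TermDefinable ρ (F b)) :
    Delta0Definable ρ fun i v => R i fun b => F b i v := by
  choose t ht using hF
  obtain ⟨φ, hφ, h⟩ := h
  refine ⟨φ.subst (Sum.elim (fun c => Term.var (Sum.inl c)) t), hφ.subst _, fun i v => ?_⟩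
  refine Iff.trans ?_ (h i fun b => F b i v)
  rw [Formula.Realize, BoundedFormula.realize_subst]
  refine iff_of_eq (congrArg₂ _ (funext fun a => ?_) rfl)
  rcases a with a | a
  · rfl
  · exact ht _ _ _

lemma subst₂ {R : ∀ i, 𝓜 i → 𝓜 i → Prop}
    (h : Delta0Definable ρ (α := Fin 2) fun i v => R i (v 0) (v 1)) (hf : TermDefinable ρ f)
    (hg : TermDefinable ρ g) : Delta0Definable ρ fun i v => R i (f i v) (g i v) :=
  h.subst (F := ![f, g]) (by simp [Fin.forall_fin_two, hf, hg])

lemma of_formula {φ : LA.Formula β} (hφ : IsDelta0 φ) {F : ∀ i, (α → 𝓜 i) → β → 𝓜 i}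
    (hF : ∀ b, TermDefinable ρ fun i v => F i v b) :
    Delta0Definable ρ fun i v => φ.Realize (F i v) :=
  subst (R := fun _ w => φ.Realize w) ⟨_, hφ.subst fun b => Term.var (Sum.inr b),
    fun _ _ => BoundedFormula.realize_subst⟩ hF

lemma realize {E : LA.Formula (Fin 2)} (hE : IsDelta0 E) (hf : TermDefinable ρ f)
    (hg : TermDefinable ρ g) : Delta0Definable ρ fun i v => E.Realize ![f i v, g i v] :=
  of_formula hE (by simp [Fin.forall_fin_two, hf, hg])

lemma existsAddMul {k : ∀ i, (α → 𝓜 i) → 𝓜 i} (hf : TermDefinable ρ f) (hg : TermDefinable ρ g)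
    (hk : TermDefinable ρ k) : Delta0Definable ρ fun i v => ∃ t, f i v = g i v + t * k i v := by
  have bounded_iff (i) (a b c : 𝓜 i) : (∃ t, a = b + t * c) ↔ ∃ t ≤ a, a = b + t * c := by
    refine ⟨?_, fun ⟨t, _, h⟩ => ⟨t, h⟩⟩
    rintro ⟨t, rfl⟩
    rcases eq_or_ne c 0 with rfl | hc
    · exact ⟨0, zero_le, by simp⟩
    · have hc1 : 1 ≤ c := Order.one_le_iff_pos.2 (pos_iff_ne_zero.2 hc)
      exact ⟨t, (le_mul_of_one_le_right zero_le hc1).trans le_add_self, rfl⟩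
  have h : Delta0Definable ρ (α := Fin 3) fun i v => ∃ t ≤ v 0, v 0 = v 1 + t * v 2 :=
    .bexLE (.var _) (.eq (.var _) (.add (.var _) (.mul (.var _) (.var _))))
  exact (h.subst (F := ![f, g, k]) (by simp [Fin.forall_fin_succ, hf, hg, hk])).of_iff fun i v =>
    bounded_iff i _ _ _

lemma dvd (hf : TermDefinable ρ f) (hg : TermDefinable ρ g) :
    Delta0Definable ρ fun i v => f i v ∣ g i v :=
  (existsAddMul hg .zero hf).of_iff fun _ _ => by
    simp only [zero_add, dvd_iff_exists_eq_mul_left]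

end Delta0Definable

end Definability

section Induction

variable {M : Theory.ModelType.{0, 0, u} IDelta0} {p : M → Prop}

/-- A set of elements of a model which is `Δ₀`-definable with parameters. -/
abbrev Delta0Pred (p : M → Prop) : Prop :=
  Delta0Definable (I := Unit) (𝓜 := fun _ => M) (fun _ c => c) (α := Unit) fun _ v => p (v ())

namespace Delta0Pred

theorem induction (hp : Delta0Pred p) (h0 : p 0) (hs : ∀ x, p x → p (x + 1)) (x : M) : p x := by
  classical
  obtain ⟨φ, hφ, h⟩ := hp
  let s : Finset M := φ.freeVarFinset.preimage Sum.inl Sum.inl_injective.injOn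
  let g : M ⊕ Unit → LA.Term (Fin s.card ⊕ Fin 1) :=
    Sum.elim (fun c => if h : c ∈ s then Term.var (Sum.inl (s.equivFin ⟨c, h⟩)) else 0)
      fun _ => Term.var (Sum.inr 0)
  have realize_subst (y : M) :
      (φ.subst g).Realize (Sum.elim (fun i => (s.equivFin.symm i : M)) fun _ => y) default ↔
        p y := by
    rw [BoundedFormula.realize_subst]
    refine Iff.trans (realize_congr_freeVar _ _ fun a ha => ?_) (h () fun _ => y)
    rcases a with c | _
    · have hc : c ∈ s := by simpa [s] using ha
      simp [g, hc]
    · rfl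
  have h_ind := (models_IDelta0_iff.1 M.is_model).2 _ (φ.subst g) (hφ.subst g)
    fun i => (s.equivFin.symm i : M)
  simp only [Formula.Realize, realize_subst, interpSucc_eq, interpZero_eq] at h_ind
  exact h_ind h0 hs x

theorem strong_induction (hp : Delta0Pred p) (h : ∀ x, (∀ y < x, p y) → p x) (x : M) : p x := by
  have below_delta0 : Delta0Pred fun x => ∀ y < x, p y :=
    .ballLT (.var ()) (hp.subst (F := fun _ _ w => w none) fun _ => .var none)
  have below : ∀ x : M, ∀ y < x, p y := below_delta0.induction (fun y hy => (not_lt_zero hy).elim)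
    fun x ih y hy => (Order.lt_add_one_iff.1 hy).lt_or_eq.elim (ih y) fun e => e ▸ h x ih
  exact h x (below x)

theorem exists_least (hp : Delta0Pred p) {x : M} (hx : p x) : ∃ x, p x ∧ ∀ y < x, ¬p y := by
  by_contra! hc
  have not_delta0 : Delta0Pred fun x => ¬p x := Delta0Definable.not hp
  refine not_delta0.strong_induction (fun y ih hy => ?_) x hx
  obtain ⟨z, hz, hpz⟩ := hc y hy
  exact ih z hz hpz

end Delta0Pred

end Induction

section Divisibility

variable {M : Theory.ModelType.{0, 0, u} IDelta0} {a b d q q' r r' : M}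

lemma le_of_dvd (h : a ∣ b) (hb : 0 < b) : a ≤ b := by
  obtain ⟨c, rfl⟩ := h
  exact le_mul_of_one_le_right zero_le (Order.one_le_iff_pos.2 (pos_of_mul_pos_right hb zero_le))

lemma pos_of_dvd (h : a ∣ b) (hb : 0 < b) : 0 < a := by
  obtain ⟨c, rfl⟩ := h
  exact pos_of_mul_pos_left hb zero_le

lemma le_two_mul (a : M) : a ≤ 2 * a := le_mul_of_one_le_left zero_le one_le_two

lemma exists_eq_add_one (h : a ≠ 0) : ∃ b, a = b + 1 := by
  obtain ⟨c, rfl⟩ := exists_add_of_le (Order.one_le_iff_pos.2 (pos_iff_ne_zero.2 h))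
  exact ⟨c, add_comm _ _⟩

lemma exists_eq_mul_add (hb : 0 < b) (a : M) : ∃ q ≤ a, ∃ r < b, a = b * q + r := by
  have h_delta0 : Delta0Pred fun a => ∃ q ≤ a, ∃ r < b, a = b * q + r :=
    .bexLE (.var _) (.bexLT (.cst b) (.eq (.var _) (.add (.mul (.cst b) (.var _)) (.var _))))
  refine h_delta0.induction ⟨0, le_rfl, 0, hb, by simp⟩ ?_ a
  rintro a ⟨q, hq, r, hr, rfl⟩
  rcases (Order.add_one_le_iff.2 hr).lt_or_eq with h | h
  · exact ⟨q, hq.trans le_self_add, r + 1, h, by ring⟩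
  · exact ⟨q + 1, by gcongr, 0, hb, by linear_combination h⟩

lemma quotient_le (hr' : r' < b) (h : b * q + r = b * q' + r') : q ≤ q' := by
  by_contra! hq
  obtain ⟨s, rfl⟩ := exists_add_of_le (Order.add_one_le_iff.2 hq)
  have hr'_eq : r' = b + (b * s + r) := by
    apply add_left_cancel (a := b * q')
    linear_combination -h
  exact hr'.not_ge (hr'_eq ▸ le_self_add)

lemma div_mod_unique (hr : r < b) (hr' : r' < b) (h : b * q + r = b * q' + r') :
    q = q' ∧ r = r' := by
  obtain rfl := le_antisymm (quotient_le hr' h) (quotient_le hr h.symm)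
  exact ⟨rfl, add_left_cancel h⟩

lemma two_mul_ne_two_mul_add_one (a b : M) : 2 * a ≠ 2 * b + 1 := fun h =>
  zero_ne_one (div_mod_unique two_pos one_lt_two ((add_zero _).trans h)).2

lemma eq_two_mul_or_eq_two_mul_add_one (a : M) : ∃ b, a = 2 * b ∨ a = 2 * b + 1 := by
  obtain ⟨q, -, r, hr, rfl⟩ := exists_eq_mul_add two_pos a
  rw [← one_add_one_eq_two, Order.lt_add_one_iff] at hr
  rcases hr.lt_or_eq with h | rfl
  · exact ⟨q, .inl (by rw [Order.lt_one_iff.1 h, add_zero])⟩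
  · exact ⟨q, .inr rfl⟩

end Divisibility

section PowersOfTwo

/-- The powers of two, defined without exponentiation as those nonzero elements all of whose
divisors other than `1` are even. -/
def IsPowTwo {M : Theory.ModelType.{0, 0, u} IDelta0} (a : M) : Prop :=
  0 < a ∧ ∀ d, d ∣ a → d = 1 ∨ 2 ∣ d

lemma Delta0Definable.isPowTwo {I Γ α : Type*} {𝓜 : I → Theory.ModelType.{0, 0, u} IDelta0}
    {ρ : ∀ i, Γ → 𝓜 i} {f : ∀ i, (α → 𝓜 i) → 𝓜 i} (hf : TermDefinable ρ f) :
    Delta0Definable ρ fun i v => IsPowTwo (f i v) := by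
  have h : Delta0Definable ρ (α := Unit) fun i v =>
      0 < v () ∧ ∀ d ≤ v (), d ∣ v () → d = 1 ∨ 2 ∣ d :=
    .and (.lt .zero (.var _)) (.ballLE (.var _) (.imp (.dvd (.var _) (.var _))
      (.or (.eq (.var _) .one) (.dvd (.ofNat 2) (.var _)))))
  refine (h.subst (F := fun _ => f) fun _ => hf).of_iff fun i v => ?_
  exact and_congr_right fun h0 => forall_congr' fun d =>
    ⟨fun h _ => h, fun h hd => h (le_of_dvd hd h0) hd⟩

variable {M : Theory.ModelType.{0, 0, u} IDelta0} {a b d : M}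

namespace IsPowTwo

lemma pos (h : IsPowTwo a) : 0 < a := h.1

lemma one_le (h : IsPowTwo a) : 1 ≤ a := Order.one_le_iff_pos.2 h.pos

lemma of_dvd (h : IsPowTwo a) (hd : d ∣ a) : IsPowTwo d :=
  ⟨pos_of_dvd hd h.1, fun _ he => h.2 _ (he.trans hd)⟩

lemma one : IsPowTwo (1 : M) :=
  ⟨one_pos, fun _ hd => .inl <|
    (le_of_dvd hd one_pos).antisymm (Order.one_le_iff_pos.2 (pos_of_dvd hd one_pos))⟩

lemma double (h : IsPowTwo a) : IsPowTwo (2 * a) := by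
  refine ⟨mul_pos two_pos h.1, ?_⟩
  rintro d ⟨c, hc⟩
  obtain ⟨e, rfl | rfl⟩ := eq_two_mul_or_eq_two_mul_add_one d
  · exact .inr (dvd_mul_right _ _)
  · obtain ⟨f, rfl | rfl⟩ := eq_two_mul_or_eq_two_mul_add_one c
    · refine h.2 _ ⟨f, mul_left_cancel₀ (two_ne_zero (α := M)) ?_⟩
      linear_combination hc
    · refine (two_mul_ne_two_mul_add_one a (e * (2 * f + 1) + f) ?_).elim
      linear_combination hc

lemma eq_one_or_eq_two_mul (h : IsPowTwo a) : a = 1 ∨ ∃ b, a = 2 * b ∧ IsPowTwo b := by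
  refine (h.2 a dvd_rfl).imp_right ?_
  rintro ⟨b, rfl⟩
  exact ⟨b, rfl, h.of_dvd (dvd_mul_left _ _)⟩

theorem induction {p : M → Prop} (hp : Delta0Pred p) (one : p 1)
    (double : ∀ a, IsPowTwo a → p a → p (2 * a)) (ha : IsPowTwo a) : p a := by
  have imp_delta0 : Delta0Pred fun a => IsPowTwo a → p a := .imp (.isPowTwo (.var _)) hp
  refine imp_delta0.strong_induction (fun a ih ha => ?_) a ha
  rcases ha.eq_one_or_eq_two_mul with rfl | ⟨b, rfl, hb⟩
  · exact one
  · exact double b hb (ih b (lt_two_mul_self hb.pos) hb)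

lemma dvd_of_le (ha : IsPowTwo a) (hb : IsPowTwo b) (h : a ≤ b) : a ∣ b := by
  have h_delta0 : Delta0Pred fun b : M => ∀ a ≤ b, IsPowTwo a → a ∣ b :=
    .ballLE (.var _) (.imp (.isPowTwo (.var _)) (.dvd (.var _) (.var _)))
  refine IsPowTwo.induction h_delta0 ?_ ?_ hb a h ha
  · intro a h ha
    rw [h.antisymm ha.one_le]
  · intro b _ ih a h ha
    rcases ha.eq_one_or_eq_two_mul with rfl | ⟨c, rfl, hc⟩
    · exact one_dvd _
    · exact mul_dvd_mul_left _ (ih c (le_of_mul_le_mul_left h two_pos) hc)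

lemma mul (ha : IsPowTwo a) (hb : IsPowTwo b) : IsPowTwo (a * b) := by
  refine IsPowTwo.induction (p := fun a => IsPowTwo (a * b)) (.isPowTwo (.mul (.var _) (.cst b)))
    (by rwa [one_mul]) (fun a _ h => ?_) ha
  rw [mul_assoc]
  exact h.double

lemma two_pow (k : ℕ) : IsPowTwo ((2 : M) ^ k) := by
  induction k with
  | zero => simpa using one
  | succ k ih => exact pow_succ' (2 : M) k ▸ ih.double

lemma two_mul_le (ha : IsPowTwo a) (hb : IsPowTwo b) (h : a < b) : 2 * a ≤ b := by
  obtain ⟨c, rfl⟩ := ha.dvd_of_le hb h.le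
  have hc : 1 < c := (lt_mul_iff_one_lt_right ha.pos).1 h
  rw [mul_comm, ← one_add_one_eq_two]
  gcongr
  exact Order.add_one_le_iff.2 hc

end IsPowTwo

lemma exists_isPowTwo_gt (z : M) : ∃ u, IsPowTwo u ∧ z < u := by
  have h_delta0 : Delta0Pred fun z : M => ∃ u ≤ 2 * z + 1, IsPowTwo u ∧ z < u :=
    .bexLE (.add (.mul (.ofNat 2) (.var _)) .one)
      (.and (.isPowTwo (.var _)) (.lt (.var _) (.var _)))
  have bounded : ∃ u ≤ 2 * z + 1, IsPowTwo u ∧ z < u := by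
    refine h_delta0.induction ⟨1, by simp, .one, one_pos⟩ ?_ z
    rintro z ⟨u, hu, hu2, hz⟩
    rcases (Order.add_one_le_iff.2 hz).lt_or_eq with h | rfl
    · exact ⟨u, hu.trans (by gcongr; exact le_self_add), hu2, h⟩
    · exact ⟨_, le_self_add, hu2.double, lt_two_mul_self hu2.pos⟩
  exact bounded.imp fun _ h => h.2

end PowersOfTwo

section ExponentiationDefinitions

variable {M : Theory.ModelType.{0, 0, u} IDelta0}

/-- `Y` is a power of the power of two `m + 1`, and its exponent is congruent to `n < m` modulo
`m`. The exponent is read off from `(m + 1) ^ n ≡ 1 + n * m` modulo `m ^ 2`. -/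
def HasLog (m n Y : M) : Prop := IsPowTwo Y ∧ n < m ∧ ∃ t, Y = 1 + n * m + t * (m * m)

/-- No power of `m + 1` up to `Z` other than `1` has an exponent divisible by `m`, so that
`HasLog m` determines the exponents of the powers of `m + 1` up to `Z`. -/
def NoWrap (m Z : M) : Prop := ∀ Y ≤ Z, IsPowTwo Y → (∃ t, Y = 1 + t * (m * m)) → Y = 1

/-- `R = 2 ^ r`, as witnessed by `R = (2 * m + 2) ^ r / (m + 1) ^ r` with powers up to `Z`. -/
def SmallExp (Z m r R : M) : Prop :=
  IsPowTwo R ∧ ∃ V ≤ Z, ∃ W ≤ Z, HasLog m r V ∧ HasLog (2 * m + 1) r W ∧ W = V * R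

/-- The base `m + 1` is suitable for computing exponents of powers of two up to `Z`. -/
def IsSuitableBase (m Z : M) : Prop :=
  IsPowTwo (m + 1) ∧ NoWrap m Z ∧ NoWrap (2 * m + 1) Z ∧
    ∀ R ≤ m + 1, IsPowTwo R → ∃ r < m, SmallExp Z m r R

/-- `y = 2 ^ x`, as witnessed by `y = (m + 1) ^ n * 2 ^ r` and `x = d * n + r`, where
`m + 1 = 2 ^ d`. -/
def ExpWithBase (Z m x y : M) : Prop :=
  ∃ Y ≤ y, ∃ R ≤ m, ∃ n < m, ∃ d < m, ∃ r < m,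
    y = Y * R ∧ HasLog m n Y ∧ SmallExp Z m d (m + 1) ∧ SmallExp Z m r R ∧ x = d * n + r

/-- The graph of exponentiation with base `2`. The factor `2 ^ 60` leaves room for a suitable base
even if `y` is small. -/
def Exp (x y : M) : Prop :=
  IsPowTwo y ∧ ∃ m ≤ 2 ^ 60 * y, IsSuitableBase m (2 ^ 60 * y) ∧ ExpWithBase (2 ^ 60 * y) m x y

end ExponentiationDefinitions

namespace Delta0Definable

variable {I : Type*} {𝓜 : I → Theory.ModelType.{0, 0, u} IDelta0} {Γ α : Type*} {ρ : ∀ i, Γ → 𝓜 i}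
  {f g k l : ∀ i, (α → 𝓜 i) → 𝓜 i}

lemma hasLog (hf : TermDefinable ρ f) (hg : TermDefinable ρ g) (hk : TermDefinable ρ k) :
    Delta0Definable ρ fun i v => HasLog (f i v) (g i v) (k i v) :=
  .and (.isPowTwo hk) (.and (.lt hg hf)
    (.existsAddMul hk (.add .one (.mul hg hf)) (.mul hf hf)))

lemma noWrap (hf : TermDefinable ρ f) (hg : TermDefinable ρ g) :
    Delta0Definable ρ fun i v => NoWrap (f i v) (g i v) :=
  subst₂ (R := fun _ m Z => NoWrap m Z) (.ballLE (.var _) (.imp (.isPowTwo (.var _)) (.imp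
    (.existsAddMul (.var _) .one (.mul (.var _) (.var _))) (.eq (.var _) .one)))) hf hg

lemma smallExp (hf : TermDefinable ρ f) (hg : TermDefinable ρ g) (hk : TermDefinable ρ k)
    (hl : TermDefinable ρ l) :
    Delta0Definable ρ fun i v => SmallExp (f i v) (g i v) (k i v) (l i v) := by
  have h : Delta0Definable ρ (α := Fin 4) fun i v => SmallExp (v 0) (v 1) (v 2) (v 3) :=
    .and (.isPowTwo (.var _)) (.bexLE (.var _) (.bexLE (.var _) (.and
      (.hasLog (.var _) (.var _) (.var _)) (.and
      (.hasLog (.add (.mul (.ofNat 2) (.var _)) .one) (.var _) (.var _))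
      (.eq (.var _) (.mul (.var _) (.var _)))))))
  exact h.subst (F := ![f, g, k, l]) (by simp [Fin.forall_fin_succ, hf, hg, hk, hl])

lemma isSuitableBase (hf : TermDefinable ρ f) (hg : TermDefinable ρ g) :
    Delta0Definable ρ fun i v => IsSuitableBase (f i v) (g i v) :=
  subst₂ (R := fun _ m Z => IsSuitableBase m Z) (.and (.isPowTwo (.add (.var _) .one)) (.and
    (.noWrap (.var _) (.var _)) (.and
    (.noWrap (.add (.mul (.ofNat 2) (.var _)) .one) (.var _))
    (.ballLE (.add (.var _) .one) (.imp (.isPowTwo (.var _)) (.bexLT (.var _)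
      (.smallExp (.var _) (.var _) (.var _) (.var _)))))))) hf hg

lemma expWithBase (hf : TermDefinable ρ f) (hg : TermDefinable ρ g) (hk : TermDefinable ρ k)
    (hl : TermDefinable ρ l) :
    Delta0Definable ρ fun i v => ExpWithBase (f i v) (g i v) (k i v) (l i v) := by
  have h : Delta0Definable ρ (α := Fin 4) fun i v => ExpWithBase (v 0) (v 1) (v 2) (v 3) :=
    .bexLE (.var _) (.bexLE (.var _) (.bexLT (.var _) (.bexLT (.var _) (.bexLT (.var _) (.and
      (.eq (.var _) (.mul (.var _) (.var _))) (.and (.hasLog (.var _) (.var _) (.var _)) (.and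
      (.smallExp (.var _) (.var _) (.var _) (.add (.var _) .one)) (.and
      (.smallExp (.var _) (.var _) (.var _) (.var _))
      (.eq (.var _) (.add (.mul (.var _) (.var _)) (.var _)))))))))))
  exact h.subst (F := ![f, g, k, l]) (by simp [Fin.forall_fin_succ, hf, hg, hk, hl])

lemma exp (hf : TermDefinable ρ f) (hg : TermDefinable ρ g) :
    Delta0Definable ρ fun i v => Exp (f i v) (g i v) :=
  subst₂ (R := fun _ x y => Exp x y) (.and (.isPowTwo (.var _)) (.bexLE
    (.mul (.pow (.ofNat 2) 60) (.var _)) (.and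
    (.isSuitableBase (.var _) (.mul (.pow (.ofNat 2) 60) (.var _)))
    (.expWithBase (.mul (.pow (.ofNat 2) 60) (.var _)) (.var _) (.var _) (.var _))))) hf hg

end Delta0Definable

section Exponentiation

variable {M : Theory.ModelType.{0, 0, u} IDelta0} {k m n r x y z R V W Y Z : M}

lemma IsPowTwo.double_base (hm : IsPowTwo (m + 1)) : IsPowTwo (2 * m + 1 + 1) := by
  convert hm.double using 1
  ring

namespace HasLog

lemma one (hm : 0 < m) : HasLog m 0 1 := ⟨.one, hm, 0, by simp⟩

lemma isPowTwo (h : HasLog m n Y) : IsPowTwo Y := h.1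

lemma eq_one (h : HasLog m 0 Y) (hm : NoWrap m Z) (hY : Y ≤ Z) : Y = 1 := by
  obtain ⟨h, -, t, ht⟩ := h
  exact hm Y hY h ⟨t, by simpa using ht⟩

lemma eq_zero (h : HasLog m n 1) : n = 0 := by
  obtain ⟨-, hn, t, ht⟩ := h
  have h0 : n * m + t * (m * m) = 0 := by
    apply add_left_cancel (a := 1)
    linear_combination -ht
  exact (mul_eq_zero.1 (add_eq_zero.1 h0).1).resolve_right (pos_of_gt hn).ne'

lemma ne_one_add_mul (h : HasLog m n Y) (hn : n ≠ 0) (x : M) : Y ≠ 1 + x * (m * m) := by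
  obtain ⟨-, hnm, t, rfl⟩ := h
  intro h
  refine hn (div_mod_unique (q := t) (q' := x) hnm (pos_of_gt hnm) ?_).2
  apply mul_left_cancel₀ (pos_of_gt hnm).ne'
  apply add_left_cancel (a := 1)
  linear_combination h

lemma succ (h : HasLog m n Y) (hm : IsPowTwo (m + 1)) (hn : n + 1 < m) :
    HasLog m (n + 1) ((m + 1) * Y) := by
  obtain ⟨hY, -, t, rfl⟩ := h
  exact ⟨hm.mul hY, hn, t * (m + 1) + n, by ring⟩

lemma succ_of_noWrap (h : HasLog m n Y) (hm : IsPowTwo (m + 1)) (hw : NoWrap m Z)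
    (hY : (m + 1) * Y ≤ Z) : HasLog m (n + 1) ((m + 1) * Y) := by
  refine h.succ hm ((Order.add_one_le_iff.2 h.2.1).lt_of_ne fun hn => ?_)
  obtain ⟨hY2, hnm, t, ht⟩ := h
  have h_eq_one := hw _ hY (hm.mul hY2) ⟨t * (m + 1) + n + 1, by rw [ht, ← hn]; ring⟩
  refine (pos_of_gt hnm).not_ge (add_le_iff_nonpos_left.1 (?_ : m + 1 ≤ 1))
  exact (le_mul_of_one_le_right zero_le hY2.one_le).trans_eq h_eq_one

lemma pred (h : HasLog m (n + 1) Y) (hm : IsPowTwo (m + 1)) :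
    ∃ Y', Y = (m + 1) * Y' ∧ HasLog m n Y' := by
  obtain ⟨hY, hn, t, ht⟩ := h
  have hnm : n < m := (Order.lt_add_one_iff.2 le_rfl).trans hn
  have h1m : 1 < m := le_add_self.trans_lt hn
  have hmY : m + 1 ≤ Y := by
    rw [ht, le_iff_exists_add]
    exact ⟨n * m + t * (m * m), by ring⟩
  obtain ⟨Y', rfl⟩ := hm.dvd_of_le hY hmY
  obtain ⟨a, -, s, hs, ha⟩ := exists_eq_mul_add (pos_of_gt hn) Y'
  obtain ⟨hquot, rfl⟩ := div_mod_unique (q := Y' + a) (q' := n + 1 + t * m) hs h1m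
    (by linear_combination ht - ha)
  obtain ⟨a', -, s', hs', ha'⟩ := exists_eq_mul_add (pos_of_gt hn) a
  obtain ⟨-, rfl⟩ := div_mod_unique (q := a' + a) (q' := t) hs' hnm
    (by
      apply add_left_cancel (a := 1)
      linear_combination hquot - ha - ha')
  exact ⟨Y', rfl, hY.of_dvd (dvd_mul_left _ _), hnm, a', by rw [ha, ha']; ring⟩

lemma le_of_double_base (h : HasLog m r V) (h' : HasLog (2 * m + 1) r W) (hm : IsPowTwo (m + 1))
    (hw : NoWrap m Z) (hw' : NoWrap (2 * m + 1) Z) (hV : V ≤ Z) (hW : W ≤ Z) : V ≤ W := by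
  have h_delta0 : Delta0Pred fun r =>
      ∀ V ≤ Z, ∀ W ≤ Z, HasLog m r V → HasLog (2 * m + 1) r W → V ≤ W :=
    .ballLE (.cst Z) (.ballLE (.cst Z) (.imp (.hasLog (.cst m) (.var _) (.var _))
      (.imp (.hasLog (.cst (2 * m + 1)) (.var _) (.var _)) (.le (.var _) (.var _)))))
  refine h_delta0.induction ?_ ?_ r V hV W hW h h'
  · intro V hV W hW h h'
    rw [h.eq_one hw hV, h'.eq_one hw' hW]
  · intro r ih V hV W hW h h'
    obtain ⟨V, rfl, hV₀⟩ := h.pred hm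
    obtain ⟨W, rfl, hW₀⟩ := h'.pred hm.double_base
    have hVW := ih V ((le_mul_of_one_le_left zero_le le_add_self).trans hV)
      W ((le_mul_of_one_le_left zero_le le_add_self).trans hW) hV₀ hW₀
    gcongr
    exact (le_two_mul m).trans le_self_add

-- The quotient of `z` by `Y` is greater than `1` and congruent to `1` modulo `k`.
lemma succ_lt (h : HasLog k n Y) (hk : IsPowTwo (k + 1)) (hn : n + 1 < k) (hz : IsPowTwo z)
    (hY : Y < z) (hzw : ∃ t, z = 1 + t * (k * k)) : (k + 1) * Y < z := by
  obtain ⟨s, hs⟩ := hzw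
  refine lt_of_le_of_ne ?_ (hs ▸ (h.succ hk hn).ne_one_add_mul (by simp) s)
  obtain ⟨hY2, -, t, ht⟩ := h
  have h1k : 1 < k := le_add_self.trans_lt hn
  obtain ⟨U, rfl⟩ := hY2.dvd_of_le hz hY.le
  obtain ⟨q, -, e, he, rfl⟩ := exists_eq_mul_add (pos_of_gt hn) U
  obtain ⟨-, rfl⟩ := div_mod_unique (q := q + (n + t * k) * (k * q + e)) (q' := s * k) he h1k
    (by
      apply add_left_cancel (a := 1 + (n * k + t * (k * k)) * (k * q + e))
      linear_combination hs - ht * (k * q + e))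
  have hq : q ≠ 0 := by
    rintro rfl
    simp at hY
  rw [mul_comm Y]
  gcongr
  exact le_mul_of_one_le_right zero_le (Order.one_le_iff_pos.2 (pos_iff_ne_zero.2 hq))

end HasLog

namespace SmallExp

lemma lt (h : SmallExp Z m r R) : r < m := by
  obtain ⟨-, V, -, W, -, h, -⟩ := h
  exact h.2.1

lemma mono (h : SmallExp Y m r R) (hYZ : Y ≤ Z) : SmallExp Z m r R := by
  obtain ⟨hR, V, hV, W, hW, h⟩ := h
  exact ⟨hR, V, hV.trans hYZ, W, hW.trans hYZ, h⟩

lemma le (h : SmallExp Z m r R) : R ≤ Z := by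
  obtain ⟨-, V, -, W, hW, hV, -, rfl⟩ := h
  exact (le_mul_of_one_le_left zero_le hV.isPowTwo.one_le).trans hW

lemma one (hm : 0 < m) (hZ : 1 ≤ Z) : SmallExp Z m 0 1 :=
  ⟨.one, 1, hZ, 1, hZ, .one hm, .one (Order.lt_add_one_iff.2 zero_le), by simp⟩

lemma eq_one (h : SmallExp Z m 0 R) (hw : NoWrap m Z) (hw' : NoWrap (2 * m + 1) Z) : R = 1 := by
  obtain ⟨-, V, hV, W, hW, h, h', hVR⟩ := h
  rwa [h.eq_one hw hV, h'.eq_one hw' hW, one_mul, eq_comm] at hVR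

lemma eq_zero (h : SmallExp Z m r 1) (hm : IsPowTwo (m + 1)) (hw : NoWrap m Z)
    (hw' : NoWrap (2 * m + 1) Z) : r = 0 := by
  obtain ⟨-, V, hV, W, -, h, h', hWV⟩ := h
  by_contra hr
  obtain ⟨r, rfl⟩ := exists_eq_add_one hr
  obtain ⟨V, rfl, hV₀⟩ := h.pred hm
  obtain ⟨W, rfl, hW₀⟩ := h'.pred hm.double_base
  obtain rfl : V = 2 * W := by
    apply mul_left_cancel₀ hm.pos.ne'
    linear_combination -hWV
  have hVZ : 2 * W ≤ Z := (le_mul_of_one_le_left zero_le le_add_self).trans hV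
  have hle : 2 * W ≤ W :=
    hV₀.le_of_double_base hW₀ hm hw hw' hVZ ((le_two_mul W).trans hVZ)
  exact hle.not_gt (lt_mul_of_one_lt_left hW₀.isPowTwo.pos one_lt_two)

lemma succ (h : SmallExp Y m r R) (hm : IsPowTwo (m + 1)) (hr : r + 1 < m)
    (hYZ : (2 * m + 1 + 1) * Y ≤ Z) : SmallExp Z m (r + 1) (2 * R) := by
  obtain ⟨hR, V, hV, W, hW, h, h', rfl⟩ := h
  have hm2 : m ≤ 2 * m + 1 := (le_two_mul m).trans le_self_add
  exact ⟨hR.double, (m + 1) * V, le_trans (by gcongr) hYZ, _, le_trans (by gcongr) hYZ,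
    h.succ hm hr, h'.succ hm.double_base (hr.trans_le hm2), by ring⟩

lemma pred (h : SmallExp Z m (r + 1) (2 * R)) (hm : IsPowTwo (m + 1)) : SmallExp Z m r R := by
  obtain ⟨hR, V, hV, W, hW, h, h', hWV⟩ := h
  obtain ⟨V, rfl, hV₀⟩ := h.pred hm
  obtain ⟨W, rfl, hW₀⟩ := h'.pred hm.double_base
  refine ⟨hR.of_dvd (dvd_mul_left _ _), V, (le_mul_of_one_le_left zero_le le_add_self).trans hV,
    W, (le_mul_of_one_le_left zero_le le_add_self).trans hW, hV₀, hW₀, ?_⟩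
  apply mul_left_cancel₀ hm.double.pos.ne'
  linear_combination hWV

lemma half (h : SmallExp Z m r (2 * R)) (hm : IsPowTwo (m + 1)) (hw : NoWrap m Z)
    (hw' : NoWrap (2 * m + 1) Z) : ∃ s, r = s + 1 ∧ SmallExp Z m s R := by
  obtain rfl | hr := eq_or_ne r 0
  · exact absurd (h.eq_one hw hw') (by simpa using two_mul_ne_two_mul_add_one R 0)
  · obtain ⟨s, rfl⟩ := exists_eq_add_one hr
    exact ⟨s, rfl, h.pred hm⟩

-- The auxiliary power `Y = (k + 1) ^ (2 * r)`, which stays below `z`, bounds the witnesses: those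
-- for `r + 1` are larger by a factor of at most `4 * (k + 1) ≤ (k + 1) ^ 2`.
lemma exists_succ (h : SmallExp Y (2 * k + 1) r R) (hY : HasLog k (2 * r) Y) (hYz : Y < z)
    (hk : IsPowTwo (k + 1)) (h15 : 15 ≤ k) (hr : 2 * r + 1 + 1 < k) (hz : IsPowTwo z)
    (hzw : ∃ t, z = 1 + t * (k * k)) :
    ∃ Y' < z, HasLog k (2 * (r + 1)) Y' ∧ SmallExp Y' (2 * k + 1) (r + 1) (2 * R) := by
  have hr' : 2 * r + 1 < k := (Order.lt_add_one_iff.2 le_rfl).trans hr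
  have hY₁ := hY.succ hk hr'
  have hY₁z := hY.succ_lt hk hr' hz hYz hzw
  refine ⟨_, hY₁.succ_lt hk hr hz hY₁z hzw, ?_, h.succ hk.double_base ?_ ?_⟩
  · convert hY₁.succ hk hr using 1
    ring
  · linear_combination hr + (zero_le : 0 ≤ r + k + 2)
  · rw [← mul_assoc]
    gcongr
    linear_combination (k + 1) * h15 + (zero_le : 0 ≤ 12 * k + 12)

end SmallExp

lemma exists_smallExp (hk : IsPowTwo (k + 1)) (h15 : 15 ≤ k) (hw : ¬ NoWrap k Z)
    (hR : IsPowTwo R) (hRk : R ≤ 2 * k + 1 + 1) : ∃ r, SmallExp Z (2 * k + 1) r R := by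
  simp only [NoWrap, not_forall] at hw
  obtain ⟨z, hzZ, hz, hzw, hz1⟩ := hw
  have hk0 : 0 < k := lt_of_lt_of_le (by norm_num) h15
  have h1z : 1 < z := hz.one_le.lt_of_ne' hz1
  suffices h : ∃ r < k, ∃ Y < z, HasLog k (2 * r) Y ∧ SmallExp Y (2 * k + 1) r R ∧
      r + 1 ≤ R ∧ 2 * r ≤ R ∧ 4 * r ≤ R + 4 by
    obtain ⟨r, -, Y, hYz, -, h, -⟩ := h
    exact ⟨r, h.mono (hYz.le.trans hzZ)⟩
  have h_delta0 : Delta0Pred fun R : M => R ≤ 2 * k + 1 + 1 → ∃ r < k, ∃ Y < z,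
      HasLog k (2 * r) Y ∧ SmallExp Y (2 * k + 1) r R ∧ r + 1 ≤ R ∧ 2 * r ≤ R ∧ 4 * r ≤ R + 4 :=
    .imp (.le (.var _) (.cst (2 * k + 1 + 1))) (.bexLT (.cst k) (.bexLT (.cst z) (.and
      (.hasLog (.cst k) (.mul (.ofNat 2) (.var _)) (.var _)) (.and
      (.smallExp (.var _) (.cst (2 * k + 1)) (.var _) (.var _)) (.and
      (.le (.add (.var _) .one) (.var _)) (.and
      (.le (.mul (.ofNat 2) (.var _)) (.var _))
      (.le (.mul (.ofNat 4) (.var _)) (.add (.var _) (.ofNat 4)))))))))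
  refine IsPowTwo.induction h_delta0 (fun _ => ?_) (fun R hR ih hRk => ?_) hR hRk
  · exact ⟨0, hk0, 1, h1z, by simpa using .one hk0, .one (by simp) le_rfl,
      by simp, by simp, by simp⟩
  · obtain ⟨r, -, Y, hYz, hY, h, h1, h2, h4⟩ := ih ((le_two_mul R).trans hRk)
    have hr : 2 * r + 1 + 1 < k := by
      refine lt_of_mul_lt_mul_left (a := 4) ?_ zero_le
      linear_combination 2 * h4 + hRk + 2 * h15
    obtain ⟨Y', hY'z, hY', h'⟩ := h.exists_succ hY hYz hk h15 hr hz hzw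
    refine ⟨r + 1, ?_, Y', hY'z, hY', h', ?_, ?_, ?_⟩
    · linear_combination hr + (zero_le : 0 ≤ r + 1)
    · linear_combination h1 + hR.one_le
    · linear_combination 2 * h1
    · linear_combination 2 * h2

lemma noWrap_of_lt (h : Z < m) : NoWrap m Z := by
  rintro Y hY hY2 ⟨t, rfl⟩
  obtain rfl | ht := eq_or_ne t 0
  · simp
  · have ht1 : 1 ≤ t := Order.one_le_iff_pos.2 (pos_iff_ne_zero.2 ht)
    have hm1 : 1 ≤ m := Order.one_le_iff_pos.2 (pos_of_gt h)
    have hmt : m ≤ t * (m * m) :=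
      (le_mul_of_one_le_left zero_le hm1).trans (le_mul_of_one_le_left zero_le ht1)
    exact ((hmt.trans (le_add_self.trans hY)).not_gt h).elim

-- `2 ^ 60 = (15 + 1) ^ 15`, which is congruent to `1 + 15 * 15` modulo `15 ^ 2`.
lemma not_noWrap_fifteen (hZ : 2 ^ 60 ≤ Z) : ¬ NoWrap 15 Z := fun hw => by
  have h := hw (2 ^ 60) hZ (.two_pow 60) ⟨5124095576030431, by norm_num⟩
  norm_num at h

lemma exists_isSuitableBase (hZ : 2 ^ 60 ≤ Z) : ∃ m, IsSuitableBase m Z := by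
  have h_delta0 : Delta0Pred fun m : M =>
      31 ≤ m ∧ IsPowTwo (m + 1) ∧ NoWrap m Z ∧ NoWrap (2 * m + 1) Z :=
    .and (.le (.ofNat 31) (.var _)) (.and (.isPowTwo (.add (.var _) .one)) (.and
      (.noWrap (.var _) (.cst Z)) (.noWrap (.add (.mul (.ofNat 2) (.var _)) .one) (.cst Z))))
  obtain ⟨u, hu, hZu⟩ := exists_isPowTwo_gt (Z + 32)
  obtain ⟨m₀, rfl⟩ := exists_eq_add_one hu.pos.ne'
  have hZm₀ : Z + 32 ≤ m₀ := Order.lt_add_one_iff.1 hZu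
  have hZ_lt : Z < m₀ := (lt_add_of_pos_right _ (by norm_num)).trans_le hZm₀
  obtain ⟨m, ⟨h31, hm, hw, hw'⟩, hmin⟩ := h_delta0.exists_least (x := m₀)
    ⟨le_trans (by norm_num) (le_add_self.trans hZm₀), hu, noWrap_of_lt hZ_lt,
      noWrap_of_lt (hZ_lt.trans_le ((le_two_mul m₀).trans le_self_add))⟩
  obtain h | ⟨u, hu, hu2⟩ := hm.eq_one_or_eq_two_mul
  · simp only [add_eq_right] at h
    exact absurd (h ▸ h31) (by norm_num)
  obtain ⟨k, rfl⟩ := exists_eq_add_one hu2.pos.ne'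
  obtain rfl : m = 2 * k + 1 := by
    apply add_right_cancel (b := 1)
    linear_combination hu
  have hk15 : 15 ≤ k := by
    refine le_of_mul_le_mul_left (a := 2) ?_ two_pos
    apply le_of_add_le_add_right (a := 1)
    linear_combination h31
  have hkw : ¬ NoWrap k Z := fun hkw => by
    obtain h | h := le_or_gt 31 k
    · exact hmin k (Order.lt_add_one_iff.2 (le_two_mul k)) ⟨h, hu2, hkw, hw⟩
    · have h16 : IsPowTwo (15 + 1 : M) := by convert IsPowTwo.two_pow (M := M) 4 using 1; norm_num
      have hk : k ≤ 15 := by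
        by_contra! hlt
        have h32 := h16.two_mul_le hu2 (by gcongr)
        exact h32.not_gt (by linear_combination h)
      exact not_noWrap_fifteen hZ (le_antisymm hk hk15 ▸ hkw)
  exact ⟨2 * k + 1, hm, hw, hw', fun R hR hR2 =>
    (exists_smallExp hu2 hk15 hkw hR2 hR).imp fun r hr => ⟨hr.lt, hr⟩⟩

lemma IsSuitableBase.pos (h : IsSuitableBase m Z) : 0 < m := by
  obtain ⟨-, -, -, h⟩ := h
  obtain ⟨r, hr, -⟩ := h 1 le_add_self .one
  exact pos_of_gt hr

lemma IsSuitableBase.le (h : IsSuitableBase m Z) : m ≤ Z := by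
  obtain ⟨hm, -, -, h⟩ := h
  obtain ⟨r, -, hr⟩ := h _ le_rfl hm
  exact le_self_add.trans hr.le

namespace ExpWithBase

lemma le (h : ExpWithBase Z m x y) : x ≤ m * m + m := by
  obtain ⟨Y, -, R, -, n, hn, d, hd, r, hr, -, -, -, -, rfl⟩ := h
  gcongr

lemma eq_zero (h : ExpWithBase Z m x 1) (hm : IsSuitableBase m Z) : x = 0 := by
  obtain ⟨Y, -, R, -, n, -, d, -, r, -, hYR, hY, -, hR, rfl⟩ := h
  obtain ⟨hm2, hw, hw', -⟩ := hm
  obtain rfl : R = 1 := le_antisymm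
    (hYR ▸ le_mul_of_one_le_left zero_le hY.isPowTwo.one_le) hR.1.one_le
  obtain rfl : Y = 1 := by rw [hYR, mul_one]
  rw [hY.eq_zero, hR.eq_zero hm2 hw hw', mul_zero, add_zero]

lemma half (h : ExpWithBase Z m x (2 * y)) (hm : IsSuitableBase m Z) (hyZ : 2 * y ≤ Z) :
    ∃ x', x = x' + 1 ∧ ExpWithBase Z m x' y := by
  obtain ⟨Y, -, R, hRm, n, -, d, hd, r, -, hYR, hY, hdm, hR, rfl⟩ := h
  obtain ⟨hm2, hw, hw', -⟩ := hm
  -- If the small factor is `1`, one factor `m + 1` of the large factor is moved to it.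
  obtain ⟨Y, n, R, r, hYR, hY, hRm, hR, hx⟩ : ∃ Y' n' R' r', 2 * y = Y' * (2 * R') ∧
      HasLog m n' Y' ∧ 2 * R' ≤ m + 1 ∧ SmallExp Z m r' (2 * R') ∧
      d * n + r = d * n' + r' := by
    obtain rfl | ⟨R, rfl, -⟩ := hR.1.eq_one_or_eq_two_mul
    · obtain rfl := hR.eq_zero hm2 hw hw'
      obtain rfl : Y = 2 * y := by rw [hYR, mul_one]
      have hn : n ≠ 0 := by
        rintro rfl
        exact two_mul_ne_two_mul_add_one y 0 (by simpa using hY.eq_one hw hyZ)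
      obtain ⟨n, rfl⟩ := exists_eq_add_one hn
      obtain ⟨Y, hYY, hY'⟩ := hY.pred hm2
      obtain h | ⟨b, hb, -⟩ := hm2.eq_one_or_eq_two_mul
      · rw [add_eq_right] at h
        exact absurd (h ▸ hd) not_lt_zero
      · exact ⟨Y, n, b, d, by rw [hYY, hb, mul_comm], hY', hb.ge, hb ▸ hdm, by ring⟩
    · exact ⟨Y, n, R, r, hYR, hY, hRm.trans le_self_add, hR, rfl⟩
  obtain ⟨r, rfl, hR'⟩ := hR.half hm2 hw hw'
  obtain rfl : y = Y * R := by
    apply mul_left_cancel₀ (two_ne_zero (α := M))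
    linear_combination hYR
  have hRm' : R ≤ m := by
    apply le_of_add_le_add_right (a := 1)
    linear_combination hRm + hR'.1.one_le
  exact ⟨d * n + r, by rw [hx, add_assoc], Y, le_mul_of_one_le_right zero_le hR'.1.one_le, R,
    hRm', n, hY.2.1, d, hd, r, hR'.lt, rfl, hY, hdm, hR', rfl⟩

end ExpWithBase

lemma IsSuitableBase.exists_expWithBase (hm : IsSuitableBase m Z) (hy : IsPowTwo y)
    (hyZ : y ≤ Z) : ∃ x, ExpWithBase Z m x y := by
  have hm0 := hm.pos
  obtain ⟨hm2, hw, -, h_small⟩ := hm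
  have h_delta0 : Delta0Pred fun y => y ≤ Z →
      ∃ Y ≤ y, ∃ R ≤ m, ∃ n < m, y = Y * R ∧ IsPowTwo R ∧ HasLog m n Y :=
    .imp (.le (.var _) (.cst Z)) (.bexLE (.var _) (.bexLE (.cst m) (.bexLT (.cst m) (.and
      (.eq (.var _) (.mul (.var _) (.var _))) (.and (.isPowTwo (.var _))
      (.hasLog (.cst m) (.var _) (.var _)))))))
  have h_factor : y ≤ Z → ∃ Y ≤ y, ∃ R ≤ m, ∃ n < m, y = Y * R ∧ IsPowTwo R ∧ HasLog m n Y := by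
    refine IsPowTwo.induction h_delta0 (fun _ => ?_) (fun y hy ih hyZ => ?_) hy
    · exact ⟨1, le_rfl, 1, Order.one_le_iff_pos.2 hm0, 0, hm0, by simp, .one, .one hm0⟩
    · obtain ⟨Y, hY, R, hR, n, hn, rfl, hR2, hlog⟩ := ih ((le_two_mul y).trans hyZ)
      have h2R : 2 * R ≤ m + 1 := hR2.two_mul_le hm2 (Order.lt_add_one_iff.2 hR)
      obtain h | h := h2R.lt_or_eq
      · exact ⟨Y, hY.trans (le_two_mul _), 2 * R, Order.lt_add_one_iff.1 h, n, hn, by ring,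
          hR2.double, hlog⟩
      · have hYR : 2 * (Y * R) = (m + 1) * Y := by linear_combination Y * h
        have hlog' := hlog.succ_of_noWrap hm2 hw (hYR ▸ hyZ)
        exact ⟨_, hYR.ge, 1, Order.one_le_iff_pos.2 hm0, n + 1, hlog'.2.1, by rw [hYR, mul_one],
          .one, hlog'⟩
  obtain ⟨Y, hY, R, hR, n, hn, hYR, hR2, hlog⟩ := h_factor hyZ
  obtain ⟨d, hdm, hd⟩ := h_small _ le_rfl hm2
  obtain ⟨r, hrm, hr⟩ := h_small R (hR.trans le_self_add) hR2
  exact ⟨_, Y, hY, R, hR, n, hn, d, hdm, r, hrm, hYR, hlog, hd, hr, rfl⟩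

lemma ExpWithBase.unique {m' x' Z' : M} (h : ExpWithBase Z m x y) (h' : ExpWithBase Z' m' x' y)
    (hm : IsSuitableBase m Z) (hm' : IsSuitableBase m' Z') (hy : IsPowTwo y)
    (hyZ : y ≤ Z) (hyZ' : y ≤ Z') : x = x' := by
  have h_delta0 : Delta0Pred fun y => y ≤ Z → y ≤ Z' → ∀ x ≤ m * m + m, ∀ x' ≤ m' * m' + m',
      ExpWithBase Z m x y → ExpWithBase Z' m' x' y → x = x' :=
    .imp (.le (.var _) (.cst Z)) (.imp (.le (.var _) (.cst Z')) (.ballLE (.cst _)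
      (.ballLE (.cst _) (.imp (.expWithBase (.cst Z) (.cst m) (.var _) (.var _))
      (.imp (.expWithBase (.cst Z') (.cst m') (.var _) (.var _)) (.eq (.var _) (.var _)))))))
  refine IsPowTwo.induction h_delta0 ?_ ?_ hy hyZ hyZ' x h.le x' h'.le h h'
  · intro _ _ x _ x' _ h h'
    rw [h.eq_zero hm, h'.eq_zero hm']
  · intro y _ ih hyZ hyZ' x _ x' _ h h'
    obtain ⟨x, rfl, hx⟩ := h.half hm hyZ
    obtain ⟨x', rfl, hx'⟩ := h'.half hm' hyZ'
    rw [ih ((le_two_mul y).trans hyZ) ((le_two_mul y).trans hyZ') x hx.le x' hx'.le hx hx']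

lemma le_two_pow_mul (y : M) (k : ℕ) : y ≤ 2 ^ k * y :=
  le_mul_of_one_le_left zero_le (one_le_pow₀ one_le_two)

lemma IsPowTwo.exists_exp (hy : IsPowTwo y) :
    ∃ m x, IsSuitableBase m (2 ^ 60 * y) ∧ ExpWithBase (2 ^ 60 * y) m x y ∧ Exp x y := by
  obtain ⟨m, hm⟩ := exists_isSuitableBase (le_mul_of_one_le_right zero_le hy.one_le)
  obtain ⟨x, hx⟩ := hm.exists_expWithBase hy (le_two_pow_mul y 60)
  exact ⟨m, x, hm, hx, hy, m, hm.le, hm, hx⟩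

namespace Exp

lemma zero_one : Exp (0 : M) 1 := by
  obtain ⟨m, x, hm, hx, h⟩ := (IsPowTwo.one (M := M)).exists_exp
  rwa [hx.eq_zero hm] at h

lemma eq_one (h : Exp 0 y) : y = 1 := by
  obtain ⟨hy, m, -, hm, h⟩ := h
  obtain rfl | ⟨y, rfl, -⟩ := hy.eq_one_or_eq_two_mul
  · rfl
  · obtain ⟨x, hx, -⟩ := h.half hm (le_two_pow_mul _ 60)
    exact ((Order.lt_add_one_iff.2 zero_le).ne hx).elim

lemma double (h : Exp x y) : Exp (x + 1) (2 * y) := by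
  obtain ⟨hy, m, -, hm, h⟩ := h
  obtain ⟨m', x', hm', hx', h_exp⟩ := hy.double.exists_exp
  obtain ⟨x', rfl, h'⟩ := hx'.half hm' (le_two_pow_mul _ 60)
  have hle : y ≤ 2 ^ 60 * (2 * y) := (le_two_mul y).trans (le_two_pow_mul _ 60)
  rwa [h.unique h' hm hm' hy (le_two_pow_mul y 60) hle]

lemma half (h : Exp (x + 1) z) : ∃ y, z = 2 * y ∧ Exp x y := by
  obtain ⟨hz, m, -, hm, h⟩ := h
  obtain rfl | ⟨y, rfl, hy⟩ := hz.eq_one_or_eq_two_mul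
  · exact absurd (h.eq_zero hm) (by simp)
  · obtain ⟨m', x', hm', hx', h_exp⟩ := hy.exists_exp
    obtain ⟨x₁, hx, hx₁⟩ := h.half hm (le_two_pow_mul _ 60)
    have hle : y ≤ 2 ^ 60 * (2 * y) := (le_two_mul y).trans (le_two_pow_mul _ 60)
    rw [hx'.unique hx₁ hm' hm hy (le_two_pow_mul y 60) hle, ← add_right_cancel hx] at h_exp
    exact ⟨y, rfl, h_exp⟩

lemma unique (h : Exp x y) (h' : Exp x z) : y = z := by
  have h_delta0 : Delta0Pred fun x => ∀ w ≤ y, ∀ w' ≤ z, Exp x w → Exp x w' → w = w' :=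
    .ballLE (.cst y) (.ballLE (.cst z) (.imp (.exp (.var _) (.var _))
      (.imp (.exp (.var _) (.var _)) (.eq (.var _) (.var _)))))
  refine h_delta0.induction ?_ ?_ x y le_rfl z le_rfl h h'
  · intro w _ w' _ h h'
    rw [h.eq_one, h'.eq_one]
  · intro x ih w hw w' hw' h h'
    obtain ⟨w, rfl, h₀⟩ := h.half
    obtain ⟨w', rfl, h₀'⟩ := h'.half
    rw [ih w ((le_two_mul w).trans hw) w' ((le_two_mul w').trans hw') h₀ h₀']

lemma exists_of_lt (h : Exp x y) (hz : z < x) : ∃ w, Exp z w := by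
  have h_delta0 : Delta0Pred fun x => ∀ v ≤ y, Exp x v → ∀ z < x, ∃ w ≤ y, Exp z w :=
    .ballLE (.cst y) (.imp (.exp (.var _) (.var _)) (.ballLT (.var _) (.bexLE (.cst y)
      (.exp (.var _) (.var _)))))
  have h_all : ∀ x, ∀ v ≤ y, Exp x v → ∀ z < x, ∃ w ≤ y, Exp z w := by
    refine h_delta0.induction (fun _ _ _ z hz => (not_lt_zero hz).elim) fun x ih v hv h z hz => ?_
    obtain ⟨w, rfl, hw⟩ := h.half
    have hwy : w ≤ y := (le_two_mul w).trans hv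
    obtain hz | rfl := (Order.lt_add_one_iff.1 hz).lt_or_eq
    · exact ih w hwy hw z hz
    · exact ⟨w, hwy, hw⟩
  exact (h_all x y le_rfl h z hz).imp fun w hw => hw.2

end Exp

end Exponentiation

section ExponentiationSentences

variable {N : Type u} [LA.Structure N] {E : LA.Formula (Fin 2)}

lemma realize_exp_zero :
    N ⊨ (app E 0 1 : LA.Sentence) ↔ E.Realize ![interpZero N, interpSucc (interpZero N)] := by
  rw [Sentence.Realize, Formula.Realize, realize_app, realize_zero, realize_one]

lemma realize_exp_unique :
    N ⊨ (∀' ∀' ∀' (app E &0 &1 ⊓ app E &0 &2 ⟹ (&1 =' &2)) : LA.Sentence) ↔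
      ∀ x y z : N, E.Realize ![x, y] → E.Realize ![x, z] → y = z := by
  simp [Sentence.Realize, Formula.Realize, Fin.snoc]

lemma realize_exp_initial :
    N ⊨ (∀' ((∃' app E &0 &1) ⟹ ballLT &0 (∃' app E &1 &2)) : LA.Sentence) ↔
      ∀ x : N, (∃ y, E.Realize ![x, y]) → ∀ z, Lt z x → ∃ y, E.Realize ![z, y] := by
  simp [Sentence.Realize, Formula.Realize, Fin.snoc]

lemma realize_exp_succ :
    N ⊨ (∀' ∀' (app E &0 &1 ⟹ app E (&0 + 1) ((1 + 1) * &1)) : LA.Sentence) ↔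
      ∀ x y : N, E.Realize ![x, y] → E.Realize ![interpAdd x (interpSucc (interpZero N)),
        interpMul (interpAdd (interpSucc (interpZero N)) (interpSucc (interpZero N))) y] := by
  simp [Sentence.Realize, Formula.Realize, Fin.snoc]

lemma realize_totality : N ⊨ totality E ↔ ∀ x : N, ∃ y, E.Realize ![x, y] := by
  simp [totality, Sentence.Realize, Formula.Realize, Fin.snoc]

end ExponentiationSentences

lemma exists_isDelta0_realize_iff_exp : ∃ E : LA.Formula (Fin 2), IsDelta0 E ∧
    ∀ (M : Theory.ModelType.{0, 0, u} IDelta0) (x y : M), E.Realize ![x, y] ↔ Exp x y := by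
  obtain ⟨φ, hφ, h⟩ : Delta0Definable (I := Theory.ModelType.{0, 0, u} IDelta0) (𝓜 := id)
      (Γ := Empty) (fun _ => Empty.elim) (α := Fin 2) fun _ v => Exp (v 0) (v 1) :=
    .exp (.var 0) (.var 1)
  refine ⟨φ.subst (Sum.elim Empty.elim Term.var), hφ.subst _, fun M x y =>
    Iff.trans ?_ (h M ![x, y])⟩
  rw [Formula.Realize, BoundedFormula.realize_subst]
  refine iff_of_eq (congrArg₂ _ (funext fun a => ?_) rfl)
  rcases a with a | a
  · exact a.elim
  · rfl

theorem exists_isExpGraph : ∃ E : LA.Formula (Fin 2), IsExpGraph E := by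
  obtain ⟨E, hE, h⟩ := exists_isDelta0_realize_iff_exp.{0}
  have models_of_forall (σ : LA.Sentence) (hσ : ∀ M : Theory.ModelType.{0, 0, 0} IDelta0, M ⊨ σ) :
      IDelta0 ⊨ᵇ σ := Theory.models_sentence_iff.2 hσ
  refine ⟨E, hE, models_of_forall _ fun M => realize_exp_zero.2 ?_,
    models_of_forall _ fun M => realize_exp_unique.2 ?_,
    models_of_forall _ fun M => realize_exp_initial.2 ?_,
    models_of_forall _ fun M => realize_exp_succ.2 ?_⟩
  · exact (h M _ _).2 .zero_one
  · simp only [h]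
    exact fun x y z => Exp.unique
  · simp only [h]
    exact fun x ⟨y, hxy⟩ z hz => hxy.exists_of_lt hz
  · simp only [h]
    intro x y hxy
    have h_double : Exp (x + 1) ((1 + 1) * y) := by
      simpa only [one_add_one_eq_two] using hxy.double
    exact h_double

section Embedding

variable {A B : Type*} [LA.Structure A] [LA.Structure B] (f : A ↪[LA] B)

lemma map_interpZero : f (interpZero A) = interpZero B :=
  (f.map_fun (Func.zero : LA.Functions 0) _).trans (congrArg _ (Subsingleton.elim _ _))

lemma map_interpSucc (a : A) : f (interpSucc a) = interpSucc (f a) :=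
  (f.map_fun (Func.succ : LA.Functions 1) _).trans
    (congrArg _ (funext fun i => by fin_cases i; rfl))

lemma map_interpAdd (a b : A) : f (interpAdd a b) = interpAdd (f a) (f b) :=
  (f.map_fun (Func.add : LA.Functions 2) _).trans
    (congrArg _ (funext fun i => by fin_cases i <;> rfl))

lemma map_interpMul (a b : A) : f (interpMul a b) = interpMul (f a) (f b) :=
  (f.map_fun (Func.mul : LA.Functions 2) _).trans
    (congrArg _ (funext fun i => by fin_cases i <;> rfl))

lemma lt_map_iff (a b : A) : Lt (f a) (f b) ↔ Lt a b := by
  rw [Lt, Lt, ← f.map_rel Rel.lt ![a, b] ]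
  exact iff_of_eq (congrArg _ (funext fun i => by fin_cases i <;> rfl))

end Embedding

section InitialSegments

variable {A : Type*} [LA.Structure A]

/-- A substructure that is an initial segment. -/
def IsInitial (N : LA.Substructure A) : Prop := ∀ a ∈ N, ∀ b, Lt b a → b ∈ N

section Absoluteness

variable {N : LA.Substructure A}

namespace IsInitial

lemma forall_lt_iff (hN : IsInitial N) (b : N) {P : A → Prop} :
    (∀ a, Lt a (N.subtype b) → P a) ↔ ∀ a : N, Lt a b → P a where
  mp h a ha := h a ((lt_map_iff N.subtype _ _).2 ha)
  mpr h a ha := h ⟨a, hN b b.2 a ha⟩ ((lt_map_iff N.subtype _ _).1 ha)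

lemma exists_lt_iff (hN : IsInitial N) (b : N) {P : A → Prop} :
    (∃ a, Lt a (N.subtype b) ∧ P a) ↔ ∃ a : N, Lt a b ∧ P a where
  mp := fun ⟨a, ha, h⟩ => ⟨⟨a, hN b b.2 a ha⟩, (lt_map_iff N.subtype _ _).1 ha, h⟩
  mpr := fun ⟨a, ha, h⟩ => ⟨a, (lt_map_iff N.subtype _ _).2 ha, h⟩

end IsInitial

theorem IsDelta0.realize_initial (hN : IsInitial N) {β : Type*} {n : ℕ}
    {φ : LA.BoundedFormula β n} (h : IsDelta0 φ) (v : β → N) (xs : Fin n → N) :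
    φ.Realize (N.subtype ∘ v) (N.subtype ∘ xs) ↔ φ.Realize v xs := by
  have realize_term {n : ℕ} (t : LA.Term (β ⊕ Fin n)) (xs : Fin n → N) :
      t.realize (Sum.elim (N.subtype ∘ v) (N.subtype ∘ xs)) =
        N.subtype (t.realize (Sum.elim v xs)) := by
    rw [← Sum.comp_elim, HomClass.realize_term]
  induction h with
  | falsum => rfl
  | equal t s =>
    rw [BoundedFormula.realize_bdEqual, BoundedFormula.realize_bdEqual, realize_term,
      realize_term, N.subtype.injective.eq_iff]
  | rel R ts =>
    simp only [BoundedFormula.Realize, realize_term]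
    exact N.subtype.map_rel R _
  | imp _ _ ih₁ ih₂ => exact imp_congr (ih₁ xs) (ih₂ xs)
  | ball t _ ih =>
    rw [realize_ballLT, realize_ballLT, realize_term, hN.forall_lt_iff]
    refine forall₂_congr fun a _ => .trans ?_ (ih _)
    rw [Fin.comp_snoc]
    rfl
  | bex t _ ih =>
    rw [realize_bexLT, realize_bexLT, realize_term, hN.exists_lt_iff]
    refine exists_congr fun a => and_congr_right fun _ => .trans ?_ (ih _)
    rw [Fin.comp_snoc]
    rfl

lemma IsDelta0.realize_formula_initial (hN : IsInitial N) {β : Type*} {φ : LA.Formula β}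
    (h : IsDelta0 φ) (v : β → N) : φ.Realize (N.subtype ∘ v) ↔ φ.Realize v := by
  rw [Formula.Realize, Formula.Realize, ← h.realize_initial hN,
    Subsingleton.elim (N.subtype ∘ default) default]

end Absoluteness

variable {M : Theory.ModelType.{0, 0, u} IDelta0} {N : LA.Substructure M}

lemma coe_interpZero : ((interpZero N : N) : M) = 0 := map_interpZero N.subtype

lemma coe_interpSucc (a : N) : ((interpSucc a : N) : M) = a + 1 :=
  (map_interpSucc N.subtype a).trans (interpSucc_eq M (a : M))

lemma zero_mem : 0 ∈ N := coe_interpZero (N := N) ▸ (interpZero N).2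

lemma add_one_mem {a : M} (ha : a ∈ N) : a + 1 ∈ N :=
  coe_interpSucc (⟨a, ha⟩ : N) ▸ (interpSucc (⟨a, ha⟩ : N)).2

namespace IsInitial

lemma mem_of_le (hN : IsInitial N) {a b : M} (ha : a ∈ N) (h : b ≤ a) : b ∈ N := by
  rcases h.lt_or_eq with h | rfl
  · exact hN a ha b h
  · exact ha

lemma lt_of_mem (hN : IsInitial N) {a b : M} (ha : a ∈ N) (hb : b ∉ N) : a < b :=
  not_le.1 fun h => hb (hN.mem_of_le ha h)

lemma paMinusLaws (hN : IsInitial N) : PAMinusLaws N := by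
  have h := Arith.paMinusLaws M
  constructor
  case exists_add =>
    intro a b hab
    obtain ⟨c, hc⟩ := h.exists_add _ _ ((lt_map_iff N.subtype _ _).2 hab)
    have hcb : c ≤ (b : M) := (le_add_self : c ≤ (a : M) + c).trans_eq hc
    exact ⟨⟨c, hN.mem_of_le b.2 hcb⟩, Subtype.ext ((map_interpAdd N.subtype _ _).trans hc)⟩
  all_goals
    simp only [← N.subtype.injective.eq_iff, ← lt_map_iff N.subtype, map_interpZero,
      map_interpSucc, map_interpAdd, map_interpMul]
    intros
  case lt_trans => exact h.lt_trans _ _ _ ‹_› ‹_›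
  case lt_irrefl => exact h.lt_irrefl _
  case lt_total => exact h.lt_total _ _
  case add_lt_add => exact h.add_lt_add _ _ _ ‹_›
  case mul_lt_mul => exact h.mul_lt_mul _ _ _ ‹_› ‹_›
  case zero_lt_one => exact h.zero_lt_one
  case discrete => exact h.discrete _ ‹_›
  case nonneg => exact h.nonneg _
  case succ_eq => exact h.succ_eq _
  case add_assoc => exact h.add_assoc _ _ _
  case add_comm => exact h.add_comm _ _
  case mul_assoc => exact h.mul_assoc _ _ _
  case mul_comm => exact h.mul_comm _ _
  case mul_add => exact h.mul_add _ _ _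
  case add_zero => exact h.add_zero _
  case mul_zero => exact h.mul_zero _
  case mul_one => exact h.mul_one _

theorem models_IDelta0 (hN : IsInitial N) : N ⊨ IDelta0 := by
  refine models_IDelta0_iff.2 ⟨hN.paMinusLaws, fun k φ hφ p h0 hs c => ?_⟩
  let P (x : M) : Prop := φ.Realize (Sum.elim (N.subtype ∘ p) fun _ => x)
  have realize_iff (x : N) : φ.Realize (Sum.elim p fun _ => x) ↔ P x := by
    rw [← hφ.realize_formula_initial hN, Sum.comp_elim]
    rfl
  simp only [realize_iff] at h0 hs ⊢
  have h_delta0 : Delta0Pred fun x : M => x ≤ c → P x := by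
    refine .imp (.le (.var _) (.cst (c : M))) (.of_formula hφ ?_)
    rintro (_ | _)
    · exact .cst _
    · exact .var _
  refine h_delta0.induction (fun _ => ?_) (fun x ih hx => ?_) c le_rfl
  · rwa [coe_interpZero] at h0
  · have hxc : x ≤ c := (Order.add_one_le_iff.1 hx).le
    have h_succ := hs ⟨x, hN.mem_of_le c.2 hxc⟩ (ih hxc)
    rwa [coe_interpSucc] at h_succ

end IsInitial

lemma exists_mem_of_forall_notMem {c : M} (hc : c ∉ N) {p : M → Prop}
    (hp : Delta0Pred p) (h : ∀ b ∉ N, p b) : ∃ b ∈ N, p b := by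
  obtain ⟨b, hb, hmin⟩ := hp.exists_least (h c hc)
  refine ⟨b, by_contra fun hbN => ?_, hb⟩
  obtain ⟨b, rfl⟩ := exists_eq_add_one fun h0 : b = 0 => hbN (h0 ▸ zero_mem)
  exact hmin b (Order.lt_add_one_iff.2 le_rfl) (h b fun hbN' => hbN (add_one_mem hbN'))

lemma realize_collectionAxiom {k : ℕ} (φ : LA.Formula (Fin k ⊕ Fin 2)) :
    A ⊨ collectionAxiom φ ↔ ∀ (p : Fin k → A) (v : A),
      (∀ x, Lt x v → ∃ y, φ.Realize (Sum.elim p ![x, y])) →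
        ∃ z, ∀ x, Lt x v → ∃ y, Lt y z ∧ φ.Realize (Sum.elim p ![x, y]) := by
  rw [collectionAxiom, realize_close]
  refine forall_congr' fun p => ?_
  have snoc₃ (v x y : A) : Sum.elim p
      (Fin.snoc (Fin.snoc (Fin.snoc default v : Fin 1 → A) x : Fin 2 → A) y : Fin 3 → A) ∘
      Sum.map id ![1, 2] = Sum.elim p ![x, y] := by
    rw [Sum.elim_comp_map]
    exact congrArg _ (by ext i; fin_cases i <;> rfl)
  have snoc₄ (v z x y : A) : Sum.elim p
      (Fin.snoc (Fin.snoc (Fin.snoc (Fin.snoc default v : Fin 1 → A) z : Fin 2 → A)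
      x : Fin 3 → A) y : Fin 4 → A) ∘ Sum.map id ![2, 3] = Sum.elim p ![x, y] := by
    rw [Sum.elim_comp_map]
    exact congrArg _ (by ext i; fin_cases i <;> rfl)
  simp only [Formula.Realize, BoundedFormula.realize_all, BoundedFormula.realize_imp,
    BoundedFormula.realize_ex, realize_ballLT, realize_bexLT, realize_ren, snoc₃, snoc₄]
  rfl

-- The quantifiers of the block are bounded by `b`, which is the value of the variable `none`.
lemma IsSigma1.exists_bounding {β : Type*} {n : ℕ} {φ : LA.BoundedFormula β n} (h : IsSigma1 φ) :
    ∃ ψ : LA.BoundedFormula (Option β) n, IsDelta0 ψ ∧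
      ∀ (M : Theory.ModelType.{0, 0, u} IDelta0) (N : LA.Substructure M), IsInitial N →
        ∀ (v : β → N) (xs : Fin n → N) (b : M),
          (b ∉ N → φ.Realize v xs →
            ψ.Realize (fun o => o.elim b (N.subtype ∘ v)) (N.subtype ∘ xs)) ∧
          (b ∈ N → ψ.Realize (fun o => o.elim b (N.subtype ∘ v)) (N.subtype ∘ xs) →
            φ.Realize v xs) := by
  induction h with
  | delta0 h =>
    refine ⟨_, h.subst fun b => Term.var (some b), fun M N hN v xs b => ?_⟩
    rw [BoundedFormula.realize_subst, ← h.realize_initial hN]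
    exact ⟨fun _ => id, fun _ => id⟩
  | ex _ ih =>
    obtain ⟨ψ, hψ, h⟩ := ih
    refine ⟨bexLT (Term.var (Sum.inl none)) ψ, .bex _ hψ, fun M N hN v xs b => ?_⟩
    rw [BoundedFormula.realize_ex, realize_bexLT]
    constructor
    · rintro hb ⟨a, ha⟩
      have hψa := (h M N hN v (Fin.snoc xs a) b).1 hb ha
      rw [Fin.comp_snoc] at hψa
      exact ⟨a, hN.lt_of_mem a.2 hb, hψa⟩
    · rintro hb ⟨a, hab, ha⟩
      refine ⟨⟨a, hN b hb a hab⟩, (h M N hN v _ b).2 hb ?_⟩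
      rw [Fin.comp_snoc]
      exact ha

lemma IsSigma1.exists_delta0Definable {α γ : Type*} {φ : LA.Formula (γ ⊕ α)} (h : IsSigma1 φ)
    (hN : IsInitial N) (p : γ → N) : ∃ B : M → (α → M) → Prop,
      Delta0Definable (I := Unit) (𝓜 := fun _ => M) (fun _ c => c) (α := Option α)
        (fun _ w => B (w none) fun a => w (some a)) ∧
      (∀ b ∉ N, ∀ x : α → N, φ.Realize (Sum.elim p x) → B b (N.subtype ∘ x)) ∧
      ∀ b ∈ N, ∀ x : α → N, B b (N.subtype ∘ x) → φ.Realize (Sum.elim p x) := by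
  obtain ⟨ψ, hψ, hb⟩ := h.exists_bounding
  have realize_iff (b : M) (x : α → N) :
      ψ.Realize (fun o => o.elim b (N.subtype ∘ Sum.elim p x)) (N.subtype ∘ default) ↔
        Formula.Realize ψ fun o => o.elim b (Sum.elim (N.subtype ∘ p) (N.subtype ∘ x)) := by
    rw [Sum.comp_elim, Subsingleton.elim (N.subtype ∘ default) default, Formula.Realize]
  refine ⟨fun b x => Formula.Realize ψ fun o => o.elim b (Sum.elim (N.subtype ∘ p) x),
    .of_formula hψ ?_, fun b hbN x hx => ?_, fun b hbN x hx => ?_⟩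
  · rintro (_ | c | a)
    · exact .var none
    · exact .cst _
    · exact .var (some a)
  · exact (realize_iff b x).1 ((hb M N hN _ _ b).1 hbN hx)
  · exact (hb M N hN _ _ b).2 hbN ((realize_iff b x).2 hx)

theorem IsInitial.models_BSigma1 (hN : IsInitial N) {c : M} (hc : c ∉ N) : N ⊨ BSigma1 := by
  rw [Theory.model_iff]
  rintro _ ⟨k, φ, hφ, rfl⟩
  rw [realize_collectionAxiom]
  intro p v h
  obtain ⟨B, hB, of_notMem, of_mem⟩ := hφ.exists_delta0Definable hN p
  have comp_pair (x y : N) : N.subtype ∘ ![x, y] = ![(x : M), (y : M)] := by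
    ext i; fin_cases i <;> rfl
  have h_delta0 : Delta0Pred fun b : M => ∀ x < (v : M), ∃ y < b, B b ![x, y] := by
    refine .ballLT (.cst (v : M)) (.bexLT (.var _) ?_)
    refine (hB.subst (F := fun o => o.elim (fun _ w => w (some (some ())))
      ![fun _ w => w (some none), fun _ w => w none]) ?_).of_iff ?_
    · rintro (_ | i)
      · exact .var _
      · fin_cases i
        · exact .var _
        · exact .var _
    · exact fun _ w => iff_of_eq (congrArg _ (by ext i; fin_cases i <;> rfl))
  obtain ⟨b, hbN, hb⟩ := exists_mem_of_forall_notMem hc h_delta0 fun b hbN x hx => by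
    obtain ⟨y, hy⟩ := h ⟨x, hN _ v.2 x hx⟩ ((lt_map_iff N.subtype _ _).1 hx)
    exact ⟨y, hN.lt_of_mem y.2 hbN, comp_pair ⟨x, _⟩ y ▸ of_notMem b hbN _ hy⟩
  refine ⟨⟨b, hbN⟩, fun x hx => ?_⟩
  obtain ⟨y, hy, hBy⟩ := hb x ((lt_map_iff N.subtype _ _).2 hx)
  have hyN := hN b hbN y hy
  exact ⟨⟨y, hyN⟩, (lt_map_iff N.subtype _ _).1 hy, of_mem b hbN _ (comp_pair x ⟨y, hyN⟩ ▸ hBy)⟩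

end InitialSegments

section ExponentiationGraphs

variable {M : Theory.ModelType.{0, 0, u} IDelta0} {E : LA.Formula (Fin 2)} {x y z : M}

namespace IsExpGraph

lemma zero_one (hE : IsExpGraph E) : E.Realize ![(0 : M), 1] :=
  realize_exp_zero.1 (hE.zero.realize_sentence M)

lemma eq_of_realize (hE : IsExpGraph E) (hy : E.Realize ![x, y]) (hz : E.Realize ![x, z]) :
    y = z :=
  realize_exp_unique.1 (hE.unique.realize_sentence M) x y z hy hz

lemma double (hE : IsExpGraph E) (h : E.Realize ![x, y]) : E.Realize ![x + 1, 2 * y] := by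
  rw [two_mul, ← one_mul y, ← add_mul]
  exact realize_exp_succ.1 (hE.succ.realize_sentence M) x y h

end IsExpGraph

end ExponentiationGraphs

lemma IsDelta0Elementary.realize_pair_iff {A : Type u} [LA.Structure A] {j : A ↪[LA] A}
    (hj : IsDelta0Elementary j.toHom.range) {E : LA.Formula (Fin 2)} (hE : IsDelta0 E) (a b : A) :
    E.Realize ![j a, j b] ↔ E.Realize ![a, b] := by
  rw [← StrongHomClass.realize_formula j.equivRange E (v := ![a, b]),
    hj 2 E hE (j.equivRange ∘ ![a, b])]
  exact iff_of_eq (congrArg _ (by ext i; fin_cases i <;> rfl))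

section SelfEmbeddings

variable {M : Theory.ModelType.{0, 0, u} IDelta0} {j : M ↪[LA] M}

lemma map_zero (j : M ↪[LA] M) : j 0 = 0 := map_interpZero j

lemma map_one (j : M ↪[LA] M) : j 1 = 1 :=
  (map_interpSucc j _).trans (congrArg _ (map_interpZero j))

lemma map_add (j : M ↪[LA] M) (a b : M) : j (a + b) = j a + j b := map_interpAdd j a b

lemma map_mul (j : M ↪[LA] M) (a b : M) : j (a * b) = j a * j b := map_interpMul j a b

lemma map_two_mul (j : M ↪[LA] M) (a : M) : j (2 * a) = 2 * j a := by
  rw [two_mul, two_mul, map_add]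

lemma map_lt_map (j : M ↪[LA] M) {a b : M} (h : a < b) : j a < j b := (lt_map_iff j a b).2 h

section Fixed

variable {a b : M}

lemma mem_ifix : a ∈ Ifix j ↔ ∀ x ≤ a, j x = x :=
  forall_congr' fun _ => by rw [le_iff_lt_or_eq]; rfl

namespace Ifix

lemma map_eq (ha : a ∈ Ifix j) : j a = a := ha a (.inr rfl)

lemma mem_of_le (ha : a ∈ Ifix j) (h : b ≤ a) : b ∈ Ifix j :=
  mem_ifix.2 fun x hx => mem_ifix.1 ha x (hx.trans h)

lemma zero_mem : (0 : M) ∈ Ifix j := by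
  rw [mem_ifix]
  intro x hx
  rw [nonpos_iff_eq_zero.1 hx, map_zero]

lemma add_mem (ha : a ∈ Ifix j) (hb : b ∈ Ifix j) : a + b ∈ Ifix j := by
  rw [mem_ifix] at *
  intro x hx
  rcases le_total x a with h | h
  · exact ha x h
  · obtain ⟨y, rfl⟩ := exists_add_of_le h
    rw [map_add, ha a le_rfl, hb y (le_of_add_le_add_left hx)]

lemma one_mem : (1 : M) ∈ Ifix j := by
  rw [mem_ifix]
  intro x hx
  rcases Order.le_one_iff.1 hx with rfl | rfl
  · exact map_zero j
  · exact map_one j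

lemma mul_mem (ha : a ∈ Ifix j) (hb : b ∈ Ifix j) : a * b ∈ Ifix j := by
  rcases eq_zero_or_pos a with rfl | ha0
  · rwa [zero_mul]
  rw [mem_ifix] at *
  intro x hx
  obtain ⟨q, -, r, hr, rfl⟩ := exists_eq_mul_add ha0 x
  have hq : q ≤ b := le_of_mul_le_mul_left (le_self_add.trans hx) ha0
  rw [map_add, map_mul, ha a le_rfl, hb q hq, ha r hr.le]

end Ifix

/-- `Ifix j` as a substructure. -/
def ifixSubstructure (j : M ↪[LA] M) : LA.Substructure M where
  carrier := Ifix j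
  fun_mem {n} f x hx := by
    cases f with
    | zero =>
      convert Ifix.zero_mem (j := j)
      exact congrArg _ (Subsingleton.elim _ _)
    | succ =>
      convert Ifix.add_mem (hx 0) Ifix.one_mem using 1
      rw [← interpSucc_eq]
      exact congrArg _ (funext fun i => by fin_cases i; rfl)
    | add =>
      convert Ifix.add_mem (hx 0) (hx 1) using 1
      exact congrArg _ (funext fun i => by fin_cases i <;> rfl)
    | mul =>
      convert Ifix.mul_mem (hx 0) (hx 1) using 1
      exact congrArg _ (funext fun i => by fin_cases i <;> rfl)

lemma isInitial_ifixSubstructure : IsInitial (ifixSubstructure j) :=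
  fun _ ha _ hb => Ifix.mem_of_le ha (le_of_lt hb)

end Fixed

section Truncations

variable {E : LA.Formula (Fin 2)} {x y i : M}

/-- `⌊x / 2 ^ i⌋ ≠ ⌊y / 2 ^ i⌋`, where `E` is the graph of `i ↦ 2 ^ i`. The power `2 ^ i` can be
bounded by `x + y`, since one of the two quotients is nonzero. -/
def TruncationsDiffer (E : LA.Formula (Fin 2)) (x y i : M) : Prop :=
  ∃ p ≤ x + y, E.Realize ![i, p] ∧ ∃ q ≤ x, ∃ s < p, ∃ q' ≤ y, ∃ s' < p,
    x = p * q + s ∧ y = p * q' + s' ∧ q ≠ q'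

lemma le_add_of_quotient_ne {p q q' s s' : M} (hq : q ≠ q') :
    p ≤ (p * q + s) + (p * q' + s') := by
  have hqq' : 1 ≤ q + q' := by
    refine Order.one_le_iff_pos.2 (pos_iff_ne_zero.2 fun h => hq ?_)
    rw [(add_eq_zero.1 h).1, (add_eq_zero.1 h).2]
  calc p ≤ p * (q + q') := le_mul_of_one_le_right zero_le hqq'
    _ ≤ p * (q + q') + (s + s') := le_self_add
    _ = _ := by ring

namespace TruncationsDiffer

lemma delta0Pred (hE : IsDelta0 E) (x y : M) : Delta0Pred (TruncationsDiffer E x y) :=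
  .bexLE (.cst (x + y)) <| .and (.realize hE (.var _) (.var _)) <|
    .bexLE (.cst x) <| .bexLT (.var _) <| .bexLE (.cst y) <| .bexLT (.var _) <|
      .and (.eq (.cst x) (.add (.mul (.var _) (.var _)) (.var _))) <|
        .and (.eq (.cst y) (.add (.mul (.var _) (.var _)) (.var _))) <|
          .not (.eq (.var _) (.var _))

lemma intro {p q q' s s' : M} (hp : E.Realize ![i, p]) (hs : s < p) (hs' : s' < p)
    (hq : q ≠ q') : TruncationsDiffer E (p * q + s) (p * q' + s') i := by
  have hp1 : 1 ≤ p := Order.one_le_iff_pos.2 (pos_of_gt hs)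
  have le_quotient (q s : M) : q ≤ p * q + s :=
    (le_mul_of_one_le_left zero_le hp1).trans le_self_add
  exact ⟨p, le_add_of_quotient_ne hq, hp, q, le_quotient q s, s, hs, q', le_quotient q' s', s', hs',
    rfl, rfl, hq⟩

end TruncationsDiffer

lemma map_eq_of_realize (hE : IsExpGraph E) (hjE : ∀ x y, E.Realize ![x, y] → E.Realize ![j x, j y])
    {p : M} (hi : j i = i) (hp : E.Realize ![i, p]) : j p = p :=
  hE.eq_of_realize (hi ▸ hjE i p hp) hp

lemma truncationsDiffer_map_iff (hE : IsExpGraph E)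
    (hjE : ∀ x y, E.Realize ![x, y] → E.Realize ![j x, j y]) (hi : j i = i) :
    TruncationsDiffer E x (j x) i ↔
      ∃ p, E.Realize ![i, p] ∧ ∃ q, ∃ s < p, x = p * q + s ∧ q ≠ j q := by
  have map_div_mod {p q s : M} (hp : E.Realize ![i, p]) (hs : s < p) :
      j s < p ∧ j (p * q + s) = p * j q + j s := by
    have hjp := map_eq_of_realize hE hjE hi hp
    exact ⟨hjp ▸ map_lt_map j hs, by rw [map_add, map_mul, hjp]⟩
  constructor
  · rintro ⟨p, -, hp, q, -, s, hs, q', -, s', hs', rfl, hx', hq⟩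
    obtain ⟨hjs, hjx⟩ := map_div_mod (q := q) hp hs
    exact ⟨p, hp, q, s, hs, rfl, (div_mod_unique hjs hs' (hjx.symm.trans hx')).1 ▸ hq⟩
  · rintro ⟨p, hp, q, s, hs, rfl, hq⟩
    obtain ⟨hjs, hjx⟩ := map_div_mod (q := q) hp hs
    rw [hjx]
    exact .intro hp hs hjs hq

lemma TruncationsDiffer.succ (hE : IsExpGraph E)
    (hjE : ∀ x y, E.Realize ![x, y] → E.Realize ![j x, j y]) (hi : j i = i)
    (h : TruncationsDiffer E x (j x) i) : TruncationsDiffer E x (j x) (i + 1) := by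
  have hi' : j (i + 1) = i + 1 := by rw [map_add, hi, map_one]
  rw [truncationsDiffer_map_iff hE hjE hi] at h
  rw [truncationsDiffer_map_iff hE hjE hi']
  obtain ⟨p, hp, q, s, hs, rfl, hq⟩ := h
  refine ⟨2 * p, hE.double hp, ?_⟩
  obtain ⟨q, rfl | rfl⟩ := eq_two_mul_or_eq_two_mul_add_one q
  · refine ⟨q, s, hs.trans_le (le_two_mul p), by ring, fun h => hq ?_⟩
    rw [map_two_mul, ← h]
  · refine ⟨q, p + s, ?_, by ring, fun h => hq ?_⟩
    · rw [two_mul]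
      gcongr
    · rw [map_add, map_two_mul, map_one, ← h]

-- If `j x ≠ x`, the truncations differ at `0`, hence up to `a`; but both vanish at `a`.
theorem map_eq_of_lt_exp (hE : IsExpGraph E)
    (hjE : ∀ x y, E.Realize ![x, y] → E.Realize ![j x, j y]) {a : M} (ha : a ∈ Ifix j)
    (hx : ∀ p, E.Realize ![a, p] → x < p) : j x = x := by
  rw [mem_ifix] at ha
  by_contra hne
  have h_delta0 : Delta0Pred fun i => i ≤ a → TruncationsDiffer E x (j x) i :=
    .imp (.le (.var _) (.cst a)) (TruncationsDiffer.delta0Pred hE.delta0 x (j x))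
  have zero : TruncationsDiffer E x (j x) 0 := by
    rw [truncationsDiffer_map_iff hE hjE (map_zero j)]
    exact ⟨1, hE.zero_one, x, 0, one_pos, by simp, Ne.symm hne⟩
  have succ (i : M) (ih : i ≤ a → TruncationsDiffer E x (j x) i) (hi : i + 1 ≤ a) :
      TruncationsDiffer E x (j x) (i + 1) :=
    have hia : i ≤ a := le_self_add.trans hi
    (ih hia).succ hE hjE (ha i hia)
  have h_differ := h_delta0.induction (fun _ => zero) succ a le_rfl
  obtain ⟨p, hp, q, s, hs, rfl, hq⟩ := (truncationsDiffer_map_iff hE hjE (ha a le_rfl)).1 h_differ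
  obtain rfl : 0 = q := (div_mod_unique (hx p hp) hs (by rw [mul_zero, zero_add])).1
  exact hq (map_zero j).symm

lemma exists_map_ne (hj : j ≠ Language.Embedding.refl LA M) : ∃ c, j c ≠ c := by
  by_contra! h
  exact hj (Language.Embedding.ext h)

theorem exists_exp_mem_ifix (hE : IsExpGraph E)
    (hjE : ∀ x y, E.Realize ![x, y] → E.Realize ![j x, j y])
    (hj : j ≠ Language.Embedding.refl LA M) {a : M} (ha : a ∈ Ifix j) :
    ∃ b ∈ Ifix j, E.Realize ![a, b] := by
  obtain ⟨c, hc⟩ := exists_map_ne hj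
  obtain ⟨p, hp, -⟩ : ∃ p, E.Realize ![a, p] ∧ p ≤ c := by
    by_contra! h
    exact hc (map_eq_of_lt_exp hE hjE ha h)
  refine ⟨p, mem_ifix.2 fun x hx => ?_, hp⟩
  rcases hx.lt_or_eq with hx | rfl
  · exact map_eq_of_lt_exp hE hjE ha fun p' hp' => hE.eq_of_realize hp hp' ▸ hx
  · exact map_eq_of_realize hE hjE (Ifix.map_eq ha) hp

end Truncations

lemma IsInitial.realize_pair_iff {E : LA.Formula (Fin 2)} {N : LA.Substructure M}
    (hN : IsInitial N) (hE : IsDelta0 E) (a b : N) :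
    E.Realize ![a, b] ↔ E.Realize ![(a : M), (b : M)] := by
  rw [← hE.realize_formula_initial hN]
  exact iff_of_eq (congrArg _ (by ext i; fin_cases i <;> rfl))

theorem ifixSubstructure_models {E : LA.Formula (Fin 2)} (hE : IsExpGraph E)
    (hjE : ∀ x y, E.Realize ![x, y] → E.Realize ![j x, j y])
    (hj : j ≠ Language.Embedding.refl LA M) :
    ifixSubstructure j ⊨ IDelta0 ∪ BSigma1 ∪ {totality E} := by
  have hI : IsInitial (ifixSubstructure j) := isInitial_ifixSubstructure
  obtain ⟨c, hc⟩ := exists_map_ne hj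
  have hcI : c ∉ ifixSubstructure j := fun h => hc (Ifix.map_eq h)
  rw [Theory.model_union_iff, Theory.model_union_iff, Theory.model_singleton_iff]
  refine ⟨⟨hI.models_IDelta0, hI.models_BSigma1 hcI⟩, realize_totality.2 fun a => ?_⟩
  obtain ⟨b, hb, h⟩ := exists_exp_mem_ifix hE hjE hj a.2
  exact ⟨⟨b, hb⟩, (hI.realize_pair_iff hE.delta0 a ⟨b, hb⟩).2 h⟩

end SelfEmbeddings

end Arith

theorem theorem3p2_general {M : Type u} [LA.Structure M] (hM : M ⊨ Arith.IDelta0)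
    (j : M ↪[LA] M) (hj : j ≠ Language.Embedding.refl LA M) {E : LA.Formula (Fin 2)}
    (hE : Arith.IsExpGraph E) (hjE : ∀ x y, E.Realize ![x, y] → E.Realize ![j x, j y]) :
    ∃ I : LA.Substructure M, (I : Set M) = Arith.Ifix j ∧
      (I ⊨ Arith.IDelta0 ∪ Arith.BSigma1 ∪ {Arith.totality E}) ∧
      ∀ a ∈ I, ∃ b ∈ I, E.Realize ![a, b] :=
  have : Nonempty M := ⟨Arith.interpZero M⟩
  let 𝓜 : Language.Theory.ModelType.{0, 0, u} Arith.IDelta0 := { Carrier := M, is_model := hM }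
  ⟨Arith.ifixSubstructure (M := 𝓜) j, rfl, Arith.ifixSubstructure_models (M := 𝓜) hE hjE hj,
    fun _ ha => Arith.exists_exp_mem_ifix (M := 𝓜) hE hjE hj ha⟩

theorem theorem3p2 {M : Type u} [LA.Structure M] (hM : M ⊨ Arith.IDelta0)
    (j : M ↪[LA] M) (hj : j ≠ Language.Embedding.refl LA M)
    (hjM : Arith.IsDelta0Elementary j.toHom.range) :
    (∃ E : LA.Formula (Fin 2), Arith.IsExpGraph E) ∧
      ∀ E : LA.Formula (Fin 2), Arith.IsExpGraph E →
        ∃ I : LA.Substructure M, (I : Set M) = Arith.Ifix j ∧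
          (I ⊨ Arith.IDelta0 ∪ Arith.BSigma1 ∪ {Arith.totality E}) ∧
          ∀ a ∈ I, ∃ b ∈ I, E.Realize ![a, b] :=
  ⟨Arith.exists_isExpGraph, fun _ hE =>
    theorem3p2_general hM j hj hE fun x y => (hjM.realize_pair_iff hE.delta0 x y).2⟩
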